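/- Fix $t\in\mathbb Q^\times$ and put $a=-\frac1{4t^2}$, $A=\frac{t^2+4}{64}$. Consider the elliptic curves $$E:\ y^2+xy+ay=x^3+ax^2,\qquad E':\ Y^2+XY+AY=X^3+AX^2$$ over $\mathbb Q$ and the isogeny $\hat\phi:E'\to E$, $(X,Y)\mapsto(x,y)$, given by $$x=-a+\left(\frac{X(2Y+X+A)}{2t(X+A)(X+2A)}\right)^2,\qquad y=x^2-\left(\frac{2(X+2A)(2Y+X+A)-tX(X+A)}{4t(X+A)(X+2A)}\right)^4,$$ whose kernel $E'[\hat\phi]$ is cyclic of order $4$, generated by $T'=\left(-2A,\ A\,\frac{2+it}4\right)$, $i=\sqrt{-1}$. Let $$\delta_{\mathbb Q}:\mathbb Q^\times/(\mathbb Q^\times)^4\to H^1\left(\mathrm{Gal}(\overline{\mathbb Q}/\mathbb Q),E'[\hat\phi]\right)$$ send $d$ to the class of the cocycle $\sigma\mapsto[m]\,T'$, where $\sigma(\sqrt[4]d)/\sqrt[4]d=i^m$. Let $WC(E'/\mathbb Q)$ be the set of equivalence classes of homogeneous spaces for $E'$ over $\mathbb Q$ (curves over $\mathbb Q$ with a simply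 transitive algebraic action of $E'$ defined over $\mathbb Q$, up to equivariant isomorphism over $\mathbb Q$), identified with $H^1(\mathrm{Gal}(\overline{\mathbb Q}/\mathbb Q),E')$ by sending $\{C\}$ to the class of $\sigma\mapsto\sigma(p_0)-p_0$ for any $p_0\in C(\overline{\mathbb Q})$. For $d\in\mathbb Q^\times$ let $C'_d$ be the smooth projective model of the affine plane curve $$d\,(w+az^2)\,z^2=(w^2-d)^2,$$ that is, the curve $uz=w^2-ds^2$, $u^2=dws+daz^2$ in $\mathbb P^3$ with coordinates $[z:w:u:s]$, where a point $(z,w)$ of the plane curve with $z\ne0$ corresponds to $[z:w:(w^2-d)/z:1]$. Then for every $d\in\mathbb Q^\times$: 1. $C'_d$ carries the structure of a homogeneous space for $E'$ over $\mathbb Q$ whose class $\{C'_d/\mathbb Q\}$ is the image of $d$ under the composite map $$\mathbb Q^\times/(\mathbb Q^\times)^4\xrightarrow{\ \delta_{\mathbb Q}\ }H^1\left(\mathrm{Gal}(\overline{\mathbb Q}/\mathbb Q),E'[\hat\phi]\right)\to WC(E'/\mathbb Q);$$ that is, $\{C'_d/\mathbb Q\}$ is the one and only element of $WC(E'/\mathbb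 Q)$ whose class in $H^1(\mathrm{Gal}(\overline{\mathbb Q}/\mathbb Q),E')$ is the image of $\delta_{\mathbb Q}(d)$. 2. There is an isomorphism $\theta:C'_d\to E'$ defined over $\overline{\mathbb Q}$ such that $\hat\phi\circ\theta:C'_d\to E$ is the map $$(z,w)\mapsto\left(\frac w{z^2},\ \frac{w^2-d}{z^4}\right)$$ (at all points $(z,w)$ of the plane curve with $z\ne0$), and such that the action of $E'$ on $C'_d$ in part 1 is $p+P=\theta^{-1}\bigl(\theta(p)-P\bigr)$. -/

import Mathlib

open scoped LinearAlgebra.Projectivization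

noncomputable section

namespace FourDescent

/-! ### The algebraic closure of `ℚ`, its Galois group, and first Galois cohomology -/

/-- An algebraic closure of `ℚ`. -/
abbrev Qbar : Type := AlgebraicClosure ℚ

/-- The unique `ℚ`-algebra structure of `ℚ̄` makes it an algebraic closure of `ℚ`. -/
instance instIsAlgClosureQbar : IsAlgClosure ℚ Qbar := by
  have h : @IsAlgClosure ℚ Qbar _ _ (AlgebraicClosure.instAlgebra ℚ) _ := inferInstance
  convert! h

instance instIsAlgebraicQbar : Algebra.IsAlgebraic ℚ Qbar := IsAlgClosure.isAlgebraic

/-- The absolute Galois group of `ℚ`; it carries the Krull topology. -/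
abbrev GQ : Type := Qbar ≃ₐ[ℚ] Qbar

instance instDecidableEqQbar : DecidableEq Qbar := Classical.decEq _

section Cohomology

variable (M : Type) [AddCommGroup M] [DistribMulAction GQ M]

theorem gal_nsmul {M : Type} [AddCommGroup M] [DistribMulAction GQ M] (σ : GQ) (n : ℕ) (x : M) :
    σ • (n • x) = n • (σ • x) :=
  map_nsmul (DistribSMul.toAddMonoidHom M σ) n x

/-- Continuous (that is, locally constant) crossed homomorphisms `ξ : Gal(ℚ̄/ℚ) → M` into the
discrete module `M`. -/
def Z1 : AddSubgroup (GQ → M) where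
  carrier := {ξ | IsLocallyConstant ξ ∧ ∀ σ τ : GQ, ξ (σ * τ) = ξ σ + σ • ξ τ}
  zero_mem' := ⟨IsLocallyConstant.const 0, fun σ τ => by simp⟩
  add_mem' := by
    rintro x y ⟨hx, hx'⟩ ⟨hy, hy'⟩
    refine ⟨hx.add hy, fun σ τ => ?_⟩
    simp only [Pi.add_apply, hx' σ τ, hy' σ τ, smul_add]
    abel
  neg_mem' := by
    rintro x ⟨hx, hx'⟩
    refine ⟨hx.neg, fun σ τ => ?_⟩
    simp only [Pi.neg_apply, hx' σ τ, smul_neg]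
    abel

/-- The principal crossed homomorphisms `σ ↦ σ m - m`. -/
def B1 : AddSubgroup (Z1 M) where
  carrier := {ξ | ∃ m : M, ∀ σ : GQ, ξ.1 σ = σ • m - m}
  zero_mem' := ⟨0, fun σ => by simp⟩
  add_mem' := by
    rintro x y ⟨m, hm⟩ ⟨n, hn⟩
    refine ⟨m + n, fun σ => ?_⟩
    simp only [AddSubgroup.coe_add, Pi.add_apply, hm σ, hn σ, smul_add]
    abel
  neg_mem' := by
    rintro x ⟨m, hm⟩
    refine ⟨-m, fun σ => ?_⟩
    simp only [AddSubgroup.coe_neg, Pi.neg_apply, hm σ, smul_neg]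
    abel

/-- The Galois cohomology group `H¹(Gal(ℚ̄/ℚ), M)` of a discrete Galois module `M`. -/
abbrev H1 : Type := Z1 M ⧸ B1 M

variable {M} {N : Type} [AddCommGroup N] [DistribMulAction GQ N]

/-- Composition of crossed homomorphisms with a Galois-equivariant homomorphism. -/
def Z1.map (f : M →+ N) (hf : ∀ (σ : GQ) (m : M), f (σ • m) = σ • f m) : Z1 M →+ Z1 N where
  toFun ξ := ⟨fun σ => f (ξ.1 σ), ξ.2.1.comp f, fun σ τ => by
    change f (ξ.1 (σ * τ)) = f (ξ.1 σ) + σ • f (ξ.1 τ)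
    rw [ξ.2.2, map_add, hf]⟩
  map_zero' := by ext σ; simp
  map_add' x y := by ext σ; simp

/-- The map induced on `H¹` by a Galois-equivariant homomorphism. -/
def H1.map (f : M →+ N) (hf : ∀ (σ : GQ) (m : M), f (σ • m) = σ • f m) : H1 M →+ H1 N :=
  QuotientAddGroup.map _ _ (Z1.map f hf) (by
    rintro ξ ⟨m, hm⟩
    exact ⟨f m, fun σ => by simp [Z1.map, hm σ, hf]⟩)

end Cohomology

theorem isLocallyConstant_apply (x : Qbar) : IsLocallyConstant (fun σ : GQ => σ x) := by
  rw [IsLocallyConstant.iff_exists_open]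
  intro σ
  refine ⟨(fun τ => σ⁻¹ * τ) ⁻¹' (MulAction.stabilizer GQ x : Set GQ),
    (stabilizer_isOpen_of_isIntegral (K := ℚ) x).preimage (continuous_const_mul σ⁻¹),
    by simp, fun τ hτ => ?_⟩
  have h : σ⁻¹ (τ x) = x := hτ
  have := congrArg σ h
  rw [← AlgEquiv.mul_apply] at this
  simpa using this

/-! ### Projective algebraic sets over `ℚ` and regular maps -/

/-- Projective space of dimension `n` over `ℚ̄`. -/
abbrev ProjSpace (n : ℕ) : Type := ℙ Qbar (Fin (n + 1) → Qbar)

/-- The Galois action on coordinates. -/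
def galVec (n : ℕ) (σ : GQ) :
    (Fin (n + 1) → Qbar) →ₛₗ[(σ : Qbar →+* Qbar)] (Fin (n + 1) → Qbar) where
  toFun v i := σ (v i)
  map_add' v w := by ext i; simp
  map_smul' c v := by ext i; simp

theorem galVec_injective (n : ℕ) (σ : GQ) : Function.Injective (galVec n σ) := by
  intro v w h
  ext i
  exact σ.injective (congrFun h i)

/-- The Galois action `[x₀ : … : xₙ] ↦ [σ x₀ : … : σ xₙ]` on projective space. -/
def galProj {n : ℕ} (σ : GQ) (p : ProjSpace n) : ProjSpace n :=
  p.map (galVec n σ) (galVec_injective n σ)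

/-- A projective algebraic set defined over `ℚ` in `n`-dimensional projective space: a set of
homogeneous equations with rational coefficients. -/
structure ProjVar (n : ℕ) : Type where
  /-- the equations -/
  eqs : Set (MvPolynomial (Fin (n + 1)) ℚ)
  homogeneous : ∀ F ∈ eqs, ∃ k, F.IsHomogeneous k

/-- A point of projective space lies on the algebraic set. -/
def ProjVar.Contains {n : ℕ} (C : ProjVar n) (p : ProjSpace n) : Prop :=
  ∀ F ∈ C.eqs, MvPolynomial.aeval p.rep F = 0

/-- The `ℚ̄`-points of a projective algebraic set. -/
def ProjVar.Pt {n : ℕ} (C : ProjVar n) : Type := {p : ProjSpace n // C.Contains p}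

/-- The embedding of the set of points in projective space. -/
def ProjVar.emb {n : ℕ} (C : ProjVar n) : C.Pt → ProjSpace n := Subtype.val

theorem aeval_smul_of_isHomogeneous {n k : ℕ} {F : MvPolynomial (Fin n) ℚ}
    (hF : F.IsHomogeneous k) (c : Qbar) (v : Fin n → Qbar) :
    MvPolynomial.aeval (c • v) F = c ^ k * MvPolynomial.aeval v F := by
  rw [MvPolynomial.aeval_def, MvPolynomial.aeval_def, MvPolynomial.eval₂_eq, MvPolynomial.eval₂_eq,
    Finset.mul_sum]
  refine Finset.sum_congr rfl fun m hm => ?_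
  have hk : ∑ i ∈ m.support, m i = k := by
    have := hF (MvPolynomial.mem_support_iff.mp hm)
    rw [← this, Finsupp.weight_apply, Finsupp.sum]
    simp
  simp only [Pi.smul_apply, smul_eq_mul, mul_pow, Finset.prod_mul_distrib, Finset.prod_pow_eq_pow_sum,
    hk]
  ring

theorem ProjVar.contains_mk {n : ℕ} (C : ProjVar n) (v : Fin (n + 1) → Qbar) (hv : v ≠ 0) :
    C.Contains (Projectivization.mk Qbar v hv) ↔ ∀ F ∈ C.eqs, MvPolynomial.aeval v F = 0 := by
  obtain ⟨c, hc⟩ := Projectivization.exists_smul_eq_mk_rep Qbar v hv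
  refine forall₂_congr fun F hF => ?_
  obtain ⟨k, hk⟩ := C.homogeneous F hF
  rw [← hc, Units.smul_def, aeval_smul_of_isHomogeneous hk]
  simp

theorem ProjVar.contains_galProj {n : ℕ} (C : ProjVar n) (σ : GQ) (p : ProjSpace n) (hp : C.Contains p) :
    C.Contains (galProj σ p) := by
  induction p using Projectivization.ind with | h v hv =>
  rw [galProj, Projectivization.map_mk, ProjVar.contains_mk]
  rw [ProjVar.contains_mk] at hp
  intro F hF
  have h1 : MvPolynomial.aeval (galVec n σ v) F = σ (MvPolynomial.aeval v F) := by
    have := MvPolynomial.comp_aeval_apply (f := v) (σ : Qbar →ₐ[ℚ] Qbar) F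
    exact this.symm
  rw [h1, hp F hF, map_zero]

/-- The Galois action on the points of a projective algebraic set over `ℚ`. -/
instance {n : ℕ} (C : ProjVar n) : MulAction GQ C.Pt where
  smul σ p := ⟨galProj σ p.1, C.contains_galProj σ p.1 p.2⟩
  one_smul := by
    rintro ⟨p, hp⟩
    refine Subtype.ext ?_
    change galProj 1 p = p
    induction p using Projectivization.ind with | h v hv => rfl
  mul_smul := by
    rintro σ τ ⟨p, hp⟩
    refine Subtype.ext ?_
    change galProj (σ * τ) p = galProj σ (galProj τ p)
    induction p using Projectivization.ind with | h v hv => rfl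

theorem ProjVar.isLocallyConstant_smul {n : ℕ} (C : ProjVar n) (p : C.Pt) :
    IsLocallyConstant (fun σ : GQ => σ • p) := by
  obtain ⟨p, hp⟩ := p
  induction p using Projectivization.ind with | h v hv =>
  rw [IsLocallyConstant.iff_eventually_eq]
  intro σ
  have h : ∀ i, ∀ᶠ τ in nhds σ, (τ : GQ) (v i) = σ (v i) := fun i =>
    (IsLocallyConstant.iff_eventually_eq _).mp (isLocallyConstant_apply (v i)) σ
  filter_upwards [Filter.eventually_all.mpr h] with τ hτ
  refine Subtype.ext ?_
  change galProj τ (Projectivization.mk Qbar v hv) = galProj σ (Projectivization.mk Qbar v hv)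
  simp only [galProj, Projectivization.map_mk]
  congr 1
  ext i
  exact hτ i

/-- Let `X` and `Y` be sets embedded in projective spaces by `ι` and `κ`.  A map `f : X → Y` is
regular (a morphism of algebraic sets over `ℚ̄`) if around every point it is given by homogeneous
polynomials of the same degree without common zero there. -/
def IsRegular {X Y : Type} {m n : ℕ} (ι : X → ProjSpace m) (κ : Y → ProjSpace n)
    (f : X → Y) : Prop :=
  ∀ x₀ : X, ∃ (k : ℕ) (F : Fin (n + 1) → MvPolynomial (Fin (m + 1)) Qbar),
    (∀ j, (F j).IsHomogeneous k) ∧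
    (fun j => MvPolynomial.eval (ι x₀).rep (F j)) ≠ 0 ∧
    ∀ (x : X) (h : (fun j => MvPolynomial.eval (ι x).rep (F j)) ≠ 0),
      κ (f x) = Projectivization.mk Qbar (fun j => MvPolynomial.eval (ι x).rep (F j)) h

/-- A polynomial in two groups of variables is bihomogeneous of bidegree `(k, l)`. -/
def IsBihomogeneous {α β : Type} (F : MvPolynomial (α ⊕ β) Qbar) (k l : ℕ) : Prop :=
  F.IsWeightedHomogeneous (Sum.elim (fun _ => 1) (fun _ => 0) : α ⊕ β → ℕ) k ∧
  F.IsWeightedHomogeneous (Sum.elim (fun _ => 0) (fun _ => 1) : α ⊕ β → ℕ) l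

/-- A map `f : X × Y → Z` is regular if around every point of the product it is given by
bihomogeneous polynomials of the same bidegree without common zero there. -/
def IsRegular₂ {X Y Z : Type} {l m n : ℕ} (ι : X → ProjSpace l) (κ : Y → ProjSpace m)
    (lam : Z → ProjSpace n) (f : X → Y → Z) : Prop :=
  ∀ (x₀ : X) (y₀ : Y), ∃ (k₁ k₂ : ℕ)
    (F : Fin (n + 1) → MvPolynomial (Fin (l + 1) ⊕ Fin (m + 1)) Qbar),
    (∀ j, IsBihomogeneous (F j) k₁ k₂) ∧
    (fun j => MvPolynomial.eval (Sum.elim (ι x₀).rep (κ y₀).rep) (F j)) ≠ 0 ∧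
    ∀ (x : X) (y : Y)
      (h : (fun j => MvPolynomial.eval (Sum.elim (ι x).rep (κ y).rep) (F j)) ≠ 0),
      lam (f x y) = Projectivization.mk Qbar
        (fun j => MvPolynomial.eval (Sum.elim (ι x).rep (κ y).rep) (F j)) h

/-! ### Points of elliptic curves over `ℚ` and the Weil-Châtelet group -/

/-- The group of `ℚ̄`-points of a Weierstrass curve over `ℚ`. -/
abbrev EPt (W : WeierstrassCurve ℚ) : Type := (W.baseChange Qbar).toAffine.Point

/-- The Galois action on `W(ℚ̄)`. -/
instance instGalEPt (W : WeierstrassCurve ℚ) : DistribMulAction GQ (EPt W) where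
  smul σ P := WeierstrassCurve.Affine.Point.map (W' := W) (σ : Qbar →ₐ[ℚ] Qbar) P
  one_smul P := by cases P <;> rfl
  mul_smul σ τ P := by cases P <;> rfl
  smul_zero σ := rfl
  smul_add σ P Q := map_add (WeierstrassCurve.Affine.Point.map (W' := W) (σ : Qbar →ₐ[ℚ] Qbar)) P Q

theorem smul_some {W : WeierstrassCurve ℚ} (σ : GQ) {x y : Qbar}
    (h : (W.baseChange Qbar).toAffine.Nonsingular x y) :
    ∃ h', σ • (WeierstrassCurve.Affine.Point.some x y h : EPt W) = .some (σ x) (σ y) h' :=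
  ⟨_, rfl⟩

/-- The embedding of `W(ℚ̄)` in the projective plane: the point at infinity is `[0 : 1 : 0]` and an
affine point `(x, y)` is `[x : y : 1]`. -/
def embE (W : WeierstrassCurve ℚ) : EPt W → ProjSpace 2
  | .zero => Projectivization.mk Qbar ![0, 1, 0] (fun h => one_ne_zero (congrFun h 1))
  | .some x y _ => Projectivization.mk Qbar ![x, y, 1] (fun h => one_ne_zero (congrFun h 2))

/-- The structure of a (principal) homogeneous space for `W` over `ℚ` on a projective algebraic set
`C` over `ℚ`: a simply transitive algebraic action of `W` on `C` defined over `ℚ`, written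
`act p P = p + P`, with the algebraic subtraction map `diff q p = q - p ∈ W`.  Over `ℚ̄`
such a `C` is isomorphic to `W` through `P ↦ p₀ + P`, so it is a smooth projective curve
whenever `W` is an elliptic curve. -/
structure TorsorStructure (W : WeierstrassCurve ℚ) {n : ℕ} (C : ProjVar n) : Type where
  nonempty : Nonempty C.Pt
  act : C.Pt → EPt W → C.Pt
  diff : C.Pt → C.Pt → EPt W
  act_zero : ∀ p, act p 0 = p
  act_add : ∀ p P Q, act p (P + Q) = act (act p P) Q
  act_diff : ∀ p q, act p (diff q p) = q
  diff_act : ∀ p P, diff (act p P) p = P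
  regular_act : IsRegular₂ C.emb (embE W) C.emb act
  regular_diff : IsRegular₂ C.emb C.emb (embE W) diff
  galois_act : ∀ (σ : GQ) p P, σ • act p P = act (σ • p) (σ • P)

/-- A homogeneous space for `W` over `ℚ`. -/
structure HomogeneousSpace (W : WeierstrassCurve ℚ) : Type where
  /-- the dimension of the ambient projective space -/
  n : ℕ
  /-- the underlying curve -/
  curve : ProjVar n
  /-- the action of `W` -/
  torsor : TorsorStructure W curve

/-- Two homogeneous spaces for `W` over `ℚ` are equivalent if there is an isomorphism between them
that is defined over `ℚ` and compatible with the actions of `W`. -/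
def HomogeneousSpace.Equivalent {W : WeierstrassCurve ℚ} (X Y : HomogeneousSpace W) : Prop :=
  ∃ e : X.curve.Pt ≃ Y.curve.Pt,
    IsRegular X.curve.emb Y.curve.emb e ∧ IsRegular Y.curve.emb X.curve.emb e.symm ∧
    (∀ (σ : GQ) p, e (σ • p) = σ • e p) ∧
    ∀ p P, e (X.torsor.act p P) = Y.torsor.act (e p) P

/-- The Weil-Châtelet group (as a set): equivalence classes of homogeneous spaces for `W`
over `ℚ`.  (`Equivalent` is an equivalence relation, as compositions of regular maps are
regular.) -/
def WC (W : WeierstrassCurve ℚ) : Type := Quot (HomogeneousSpace.Equivalent (W := W))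

/-- The class in `WC(W/ℚ)` of a homogeneous space. -/
def WC.mk {W : WeierstrassCurve ℚ} (X : HomogeneousSpace W) : WC W := Quot.mk _ X

namespace TorsorStructure

variable {W : WeierstrassCurve ℚ} {n : ℕ} {C : ProjVar n} (μ : TorsorStructure W C)

theorem act_left_cancel {p : C.Pt} {P Q : EPt W} (h : μ.act p P = μ.act p Q) : P = Q := by
  rw [← μ.diff_act p P, h, μ.diff_act]

theorem diff_eq_iff {p q : C.Pt} {P : EPt W} : μ.diff q p = P ↔ μ.act p P = q :=
  ⟨fun h => h ▸ μ.act_diff p q, fun h => h ▸ μ.diff_act p P⟩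

/-- The crossed homomorphism `σ ↦ σ(p₀) - p₀` attached to a point `p₀` of a homogeneous space. -/
def cocycle (p₀ : C.Pt) : Z1 (EPt W) :=
  ⟨fun σ => μ.diff (σ • p₀) p₀,
    (C.isLocallyConstant_smul p₀).comp (fun q => μ.diff q p₀), fun σ τ => by
      rw [diff_eq_iff, act_add, act_diff, ← galois_act, act_diff, mul_smul]⟩

theorem cocycle_class_eq (p₀ p₁ : C.Pt) :
    (QuotientAddGroup.mk (μ.cocycle p₀) : H1 (EPt W)) = QuotientAddGroup.mk (μ.cocycle p₁) := by
  rw [QuotientAddGroup.eq]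
  refine ⟨μ.diff p₁ p₀, fun σ => ?_⟩
  change -μ.diff (σ • p₀) p₀ + μ.diff (σ • p₁) p₁ = _
  have key : μ.diff p₁ p₀ + μ.diff (σ • p₁) p₁ = μ.diff (σ • p₀) p₀ + σ • μ.diff p₁ p₀ := by
    apply μ.act_left_cancel (p := p₀)
    rw [act_add, act_diff, act_diff, act_add, act_diff, ← galois_act, act_diff]
  rw [eq_sub_iff_add_eq, add_assoc, add_comm (μ.diff (σ • p₁) p₁), key]
  abel

end TorsorStructure

/-- The class in `H¹(Gal(ℚ̄/ℚ), W(ℚ̄))` of the crossed homomorphisms `σ ↦ σ(p₀) - p₀`, where `p₀`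
is any point of the homogeneous space. -/
def HomogeneousSpace.cohomologyClass {W : WeierstrassCurve ℚ} (X : HomogeneousSpace W) :
    H1 (EPt W) :=
  QuotientAddGroup.mk (X.torsor.cocycle (Classical.choice X.torsor.nonempty))

/-- The natural map `WC(W/ℚ) → H¹(Gal(ℚ̄/ℚ), W(ℚ̄))`, `{C} ↦ {σ ↦ σ(p₀) - p₀}`. -/
def WC.toH1 {W : WeierstrassCurve ℚ} : WC W → H1 (EPt W) :=
  Quot.lift HomogeneousSpace.cohomologyClass (by
    rintro X Y ⟨e, -, -, hσ, hact⟩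
    rw [HomogeneousSpace.cohomologyClass, HomogeneousSpace.cohomologyClass]
    set p := Classical.choice X.torsor.nonempty
    rw [Y.torsor.cocycle_class_eq _ (e p)]
    congr 1
    refine Subtype.ext (funext fun σ => ?_)
    change X.torsor.diff (σ • p) p = Y.torsor.diff (σ • e p) (e p)
    symm
    rw [TorsorStructure.diff_eq_iff, ← hact, TorsorStructure.act_diff, hσ])

/-! ### The curves `E` and `E'`, the dual isogeny, and its kernel -/

section Curves

variable (t : ℚˣ)

/-- `a = -1 / (4 t²)`. -/
def a : ℚ := -1 / (4 * (t : ℚ) ^ 2)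

/-- `A = (t² + 4) / 64`. -/
def A : ℚ := ((t : ℚ) ^ 2 + 4) / 64

/-- `E : y² + x y + a y = x³ + a x²`. -/
def E : WeierstrassCurve ℚ := ⟨1, a t, a t, 0, 0⟩

/-- `E' : Y² + X Y + A Y = X³ + A X²`. -/
def E' : WeierstrassCurve ℚ := ⟨1, A t, A t, 0, 0⟩

/-- The images of `t`, `a` and `A` in `ℚ̄`. -/
def tb : Qbar := algebraMap ℚ Qbar t
def ab : Qbar := algebraMap ℚ Qbar (a t)
def Ab : Qbar := algebraMap ℚ Qbar (A t)

theorem Ab_fold : algebraMap ℚ Qbar (A t) = Ab t := rfl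

theorem tb_ne_zero : tb t ≠ 0 := by
  rw [tb, Ne, map_eq_zero]
  exact t.ne_zero

theorem A_pos : 0 < A t := by
  rw [A]
  positivity

theorem Ab_ne_zero : Ab t ≠ 0 := by
  rw [Ab, Ne, map_eq_zero]
  exact (A_pos t).ne'

theorem ab_eq : ab t = -1 / (4 * tb t ^ 2) := by
  simp [ab, a, tb]

theorem Ab_eq : Ab t = (tb t ^ 2 + 4) / 64 := by
  simp [Ab, A, tb]

theorem E_Δ_ne_zero : (E t).Δ ≠ 0 := by
  have ht : (t : ℚ) ≠ 0 := t.ne_zero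
  have h : (E t).Δ = (a t) ^ 4 * (1 - 16 * a t) := by
    simp only [WeierstrassCurve.Δ, WeierstrassCurve.b₂, WeierstrassCurve.b₄, WeierstrassCurve.b₆,
      WeierstrassCurve.b₈, E]
    ring
  have ha : a t < 0 := by
    rw [a]
    exact div_neg_of_neg_of_pos (by norm_num) (by positivity)
  rw [h]
  exact mul_ne_zero (pow_ne_zero _ ha.ne) (by linarith)

theorem E'_Δ_ne_zero : (E' t).Δ ≠ 0 := by
  have ht : (t : ℚ) ≠ 0 := t.ne_zero
  have h : (E' t).Δ = (A t) ^ 4 * (1 - 16 * A t) := by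
    simp only [WeierstrassCurve.Δ, WeierstrassCurve.b₂, WeierstrassCurve.b₄, WeierstrassCurve.b₆,
      WeierstrassCurve.b₈, E']
    ring
  have hA : 1 - 16 * A t = -((t : ℚ) ^ 2 / 4) := by rw [A]; ring
  rw [h, hA]
  exact mul_ne_zero (pow_ne_zero _ (A_pos t).ne') (neg_ne_zero.mpr (by positivity))

theorem E_equation_iff (x y : Qbar) : ((E t).baseChange Qbar).toAffine.Equation x y ↔
    y ^ 2 + x * y + ab t * y = x ^ 3 + ab t * x ^ 2 := by
  rw [WeierstrassCurve.Affine.equation_iff]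
  simp [E, ab, WeierstrassCurve.baseChange, WeierstrassCurve.map]

theorem E'_equation_iff (x y : Qbar) : ((E' t).baseChange Qbar).toAffine.Equation x y ↔
    y ^ 2 + x * y + Ab t * y = x ^ 3 + Ab t * x ^ 2 := by
  rw [WeierstrassCurve.Affine.equation_iff]
  simp [E', Ab, WeierstrassCurve.baseChange, WeierstrassCurve.map]

theorem E_nonsingular_of_equation {x y : Qbar}
    (h : y ^ 2 + x * y + ab t * y = x ^ 3 + ab t * x ^ 2) :
    ((E t).baseChange Qbar).toAffine.Nonsingular x y := by
  rw [← WeierstrassCurve.Affine.equation_iff_nonsingular_of_Δ_ne_zero, E_equation_iff]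
  · exact h
  · change ((E t).baseChange Qbar).Δ ≠ 0
    rw [WeierstrassCurve.baseChange, WeierstrassCurve.map_Δ, Ne, map_eq_zero]
    exact E_Δ_ne_zero t

theorem E'_nonsingular_of_equation {x y : Qbar}
    (h : y ^ 2 + x * y + Ab t * y = x ^ 3 + Ab t * x ^ 2) :
    ((E' t).baseChange Qbar).toAffine.Nonsingular x y := by
  rw [← WeierstrassCurve.Affine.equation_iff_nonsingular_of_Δ_ne_zero, E'_equation_iff]
  · exact h
  · change ((E' t).baseChange Qbar).Δ ≠ 0
    rw [WeierstrassCurve.baseChange, WeierstrassCurve.map_Δ, Ne, map_eq_zero]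
    exact E'_Δ_ne_zero t

theorem E'_equation_of_nonsingular {x y : Qbar}
    (h : ((E' t).baseChange Qbar).toAffine.Nonsingular x y) :
    y ^ 2 + x * y + Ab t * y = x ^ 3 + Ab t * x ^ 2 :=
  (E'_equation_iff t x y).mp h.1

/-- The `x`-coordinate of `φ̂(X, Y)`. -/
def isogX (X Y : Qbar) : Qbar :=
  -ab t + (X * (2 * Y + X + Ab t) / (2 * tb t * (X + Ab t) * (X + 2 * Ab t))) ^ 2

/-- The `y`-coordinate of `φ̂(X, Y)`. -/
def isogY (X Y : Qbar) : Qbar :=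
  isogX t X Y ^ 2 -
    ((2 * (X + 2 * Ab t) * (2 * Y + X + Ab t) - tb t * X * (X + Ab t)) /
      (4 * tb t * (X + Ab t) * (X + 2 * Ab t))) ^ 4

theorem tb_sq : tb t ^ 2 = 64 * Ab t - 4 := by rw [Ab_eq]; ring

/-- The formulas for `φ̂` define a point of `E`. -/
theorem isog_equation {X Y : Qbar} (h : Y ^ 2 + X * Y + Ab t * Y = X ^ 3 + Ab t * X ^ 2)
    (h₁ : X + Ab t ≠ 0) (h₂ : X + 2 * Ab t ≠ 0) :
    isogY t X Y ^ 2 + isogX t X Y * isogY t X Y + ab t * isogY t X Y =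
      isogX t X Y ^ 3 + ab t * isogX t X Y ^ 2 := by
  have ht := tb_ne_zero t
  obtain ⟨p, hp⟩ : ∃ p, p = (2 * Y + X + Ab t) / (2 * tb t * (X + Ab t)) := ⟨_, rfl⟩
  obtain ⟨q, hq⟩ : ∃ q, q = X / (4 * (X + 2 * Ab t)) := ⟨_, rfl⟩
  have hS : (2 * Y + X + Ab t) ^ 2 = (X + Ab t) * (4 * X ^ 2 + X + Ab t) := by
    linear_combination 4 * h
  have hp2 : p ^ 2 = (4 * X ^ 2 + X + Ab t) / (4 * tb t ^ 2 * (X + Ab t)) := by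
    rw [hp, div_pow, hS]
    field_simp
    ring
  have e1 : X * (2 * Y + X + Ab t) / (2 * tb t * (X + Ab t) * (X + 2 * Ab t)) = 4 * p * q := by
    rw [hp, hq]
    field_simp
  have e2 : (2 * (X + 2 * Ab t) * (2 * Y + X + Ab t) - tb t * X * (X + Ab t)) /
      (4 * tb t * (X + Ab t) * (X + 2 * Ab t)) = p - q := by
    rw [hp, hq]
    field_simp
    ring
  have key : p ^ 2 - q ^ 2 = 16 * p ^ 2 * q ^ 2 - ab t := by
    have h3 : p ^ 2 * (4 * tb t ^ 2 * (X + Ab t)) = 4 * X ^ 2 + X + Ab t := by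
      rw [hp2]
      field_simp
    have h4 : 16 * (X + 2 * Ab t) ^ 2 * q ^ 2 = X ^ 2 := by
      rw [hq]
      field_simp
      ring
    have h5 : ab t * (4 * tb t ^ 2) = -1 := by
      rw [ab_eq]
      field_simp
    have h6 : 4 * tb t ^ 2 * (X + Ab t) * (16 * (X + 2 * Ab t) ^ 2) ≠ 0 :=
      mul_ne_zero (mul_ne_zero (mul_ne_zero (by norm_num) (pow_ne_zero _ ht)) h₁)
        (mul_ne_zero (by norm_num) (pow_ne_zero _ h₂))
    apply mul_right_cancel₀ h6
    linear_combination (16 * (X + 2 * Ab t) ^ 2 - 16 * (16 * (X + 2 * Ab t) ^ 2 * q ^ 2)) * h3 -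
      (4 * tb t ^ 2 * (X + Ab t) + 16 * (4 * X ^ 2 + X + Ab t)) * h4 +
      16 * (X + Ab t) * (X + 2 * Ab t) ^ 2 * h5 - 4 * X ^ 2 * (X + Ab t) * tb_sq t
  have hx : isogX t X Y = p ^ 2 - q ^ 2 := by
    rw [isogX, e1]
    linear_combination -key
  have hy : isogY t X Y = (p - q) ^ 2 * (4 * p * q) := by
    rw [isogY, hx, e2]
    ring
  rw [hx, hy]
  linear_combination -(p - q) ^ 4 * key

/-- The dual isogeny `φ̂ : E' → E` on `ℚ̄`-points: it is given by the explicit formulas wherever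
these are defined, and sends the remaining points (the point at infinity and the points with
`X = -A` or `X = -2A`) to the point at infinity. -/
def phiHat : EPt (E' t) → EPt (E t)
  | .zero => .zero
  | .some X Y h =>
    if hX : X + Ab t ≠ 0 ∧ X + 2 * Ab t ≠ 0 then
      .some (isogX t X Y) (isogY t X Y)
        (E_nonsingular_of_equation t (isog_equation t (E'_equation_of_nonsingular t h) hX.1 hX.2))
    else .zero

/-- A square root of `-1` in `ℚ̄`. -/
def im : Qbar := Classical.choose (IsAlgClosed.exists_pow_nat_eq (-1 : Qbar) two_pos)

theorem im_sq : im ^ 2 = -1 :=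
  Classical.choose_spec (IsAlgClosed.exists_pow_nat_eq (-1 : Qbar) two_pos)

theorem im_ne_zero : im ≠ 0 := by
  intro h
  have := im_sq
  rw [h] at this
  norm_num at this

theorem T'_nonsingular : ((E' t).baseChange Qbar).toAffine.Nonsingular (-2 * Ab t)
    (Ab t * (2 + im * tb t) / 4) :=
  E'_nonsingular_of_equation t (by
    linear_combination (Ab t ^ 2 / 16) * tb t ^ 2 * im_sq - Ab t ^ 2 / 16 * tb_sq t)

/-- The point `T' = (-2A, A (2 + i t) / 4)` of `E'`. -/
def T' : EPt (E' t) :=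
  .some (-2 * Ab t) (Ab t * (2 + im * tb t) / 4) (T'_nonsingular t)

/-- The point `(-A, 0)` of `E'`. -/
def D' : EPt (E' t) :=
  .some (-Ab t) 0 (E'_nonsingular_of_equation t (by ring))

theorem T'_add_T' : T' t + T' t = D' t := by
  have hA := Ab_ne_zero t
  have ht := tb_ne_zero t
  have hi := im_ne_zero
  have hn : ((E' t).baseChange Qbar).toAffine.negY (-2 * Ab t) (Ab t * (2 + im * tb t) / 4) =
      Ab t * (2 - im * tb t) / 4 := by
    simp only [WeierstrassCurve.Affine.negY, E', WeierstrassCurve.baseChange, WeierstrassCurve.map]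
    simp only [map_one, Ab_fold]
    ring
  have hne : Ab t * (2 + im * tb t) / 4 ≠
      ((E' t).baseChange Qbar).toAffine.negY (-2 * Ab t) (Ab t * (2 + im * tb t) / 4) := by
    rw [hn]
    intro h
    have : Ab t * (im * tb t) = 0 := by linear_combination 2 * h
    simp_all
  have hsl : ((E' t).baseChange Qbar).toAffine.slope (-2 * Ab t) (-2 * Ab t)
      (Ab t * (2 + im * tb t) / 4) (Ab t * (2 + im * tb t) / 4) = (-im * tb t - 2) / 4 := by
    rw [WeierstrassCurve.Affine.slope_of_Y_ne rfl hne, hn]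
    have hd : Ab t * (2 + im * tb t) / 4 - Ab t * (2 - im * tb t) / 4 ≠ 0 := by
      rw [show Ab t * (2 + im * tb t) / 4 - Ab t * (2 - im * tb t) / 4 = Ab t * (im * tb t) / 2 by
        ring]
      simp_all
    rw [div_eq_iff hd]
    simp only [E', WeierstrassCurve.baseChange, WeierstrassCurve.map]
    simp only [map_one, map_zero, Ab_fold]
    linear_combination (Ab t / 8) * tb t ^ 2 * im_sq - (Ab t / 8) * tb_sq t
  rw [T', WeierstrassCurve.Affine.Point.add_self_of_Y_ne hne, D']
  have hx : ((E' t).baseChange Qbar).toAffine.addX (-2 * Ab t) (-2 * Ab t)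
      (((E' t).baseChange Qbar).toAffine.slope (-2 * Ab t) (-2 * Ab t)
      (Ab t * (2 + im * tb t) / 4) (Ab t * (2 + im * tb t) / 4)) = -Ab t := by
    rw [hsl]
    simp only [WeierstrassCurve.Affine.addX, E', WeierstrassCurve.baseChange, WeierstrassCurve.map]
    simp only [map_one, Ab_fold]
    linear_combination (tb t ^ 2 / 16) * im_sq - (1 / 16) * tb_sq t
  have hy : ((E' t).baseChange Qbar).toAffine.addY (-2 * Ab t) (-2 * Ab t)
      (Ab t * (2 + im * tb t) / 4)
      (((E' t).baseChange Qbar).toAffine.slope (-2 * Ab t) (-2 * Ab t)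
      (Ab t * (2 + im * tb t) / 4) (Ab t * (2 + im * tb t) / 4)) = 0 := by
    rw [WeierstrassCurve.Affine.addY, WeierstrassCurve.Affine.negAddY, hx, hsl]
    simp only [WeierstrassCurve.Affine.negY, E', WeierstrassCurve.baseChange, WeierstrassCurve.map]
    simp only [map_one, Ab_fold]
    ring
  simp only [hx, hy]

theorem D'_add_D' : D' t + D' t = 0 := by
  rw [D']
  apply WeierstrassCurve.Affine.Point.add_self_of_Y_eq
  simp only [WeierstrassCurve.Affine.negY, E', WeierstrassCurve.baseChange, WeierstrassCurve.map]
  simp only [map_one, Ab_fold]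
  ring

theorem four_nsmul_T' : 4 • T' t = 0 := by
  rw [show (4 : ℕ) = 2 * 2 from rfl, mul_nsmul, two_nsmul (T' t), T'_add_T', two_nsmul, D'_add_D']

theorem neg_T' : ∃ h, -T' t =
    .some (-2 * Ab t) (Ab t * (2 - im * tb t) / 4) h := by
  have hn : ((E' t).baseChange Qbar).toAffine.negY (-2 * Ab t) (Ab t * (2 + im * tb t) / 4) =
      Ab t * (2 - im * tb t) / 4 := by
    simp only [WeierstrassCurve.Affine.negY, E', WeierstrassCurve.baseChange, WeierstrassCurve.map]
    simp only [map_one, Ab_fold]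
    ring
  have h := (WeierstrassCurve.Affine.nonsingular_neg _ _).mpr (T'_nonsingular t)
  rw [hn] at h
  refine ⟨h, ?_⟩
  rw [T', WeierstrassCurve.Affine.Point.neg_some]
  simp only [hn]

/-- The kernel of `φ̂` consists of the four multiples of `T'`. -/
theorem phiHat_eq_zero_iff (P : EPt (E' t)) :
    phiHat t P = 0 ↔ P ∈ AddSubgroup.zmultiples (T' t) := by
  have hA := Ab_ne_zero t
  have hT : phiHat t (T' t) = 0 := by
    rw [T', phiHat, dif_neg (by simp)]
    rfl
  have hD : phiHat t (D' t) = 0 := by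
    rw [D', phiHat, dif_neg (by simp)]
    rfl
  have hN : phiHat t (-T' t) = 0 := by
    obtain ⟨h, e⟩ := neg_T' t
    rw [e, phiHat, dif_neg (by simp)]
    rfl
  constructor
  · intro h
    obtain _ | ⟨X, Y, hXY⟩ := P
    · exact AddSubgroup.zero_mem _
    have hE := E'_equation_of_nonsingular t hXY
    have hX : ¬ (X + Ab t ≠ 0 ∧ X + 2 * Ab t ≠ 0) := by
      intro hX
      rw [phiHat, dif_pos hX] at h
      exact WeierstrassCurve.Affine.Point.some_ne_zero _ h
    rw [not_and_or, not_not, not_not] at hX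
    rcases hX with hX | hX
    · have hX' : X = -Ab t := by linear_combination hX
      subst hX'
      have hY : Y = 0 := by
        have : Y ^ 2 = 0 := by linear_combination hE
        simpa using this
      subst hY
      exact ⟨2, by
        change (2 : ℤ) • T' t = D' t
        rw [two_zsmul, T'_add_T']⟩
    · have hX' : X = -2 * Ab t := by linear_combination hX
      subst hX'
      have hY : (Y - Ab t * (2 + im * tb t) / 4) * (Y - Ab t * (2 - im * tb t) / 4) = 0 := by
        linear_combination hE - (Ab t ^ 2 / 16) * tb t ^ 2 * im_sq + Ab t ^ 2 / 16 * tb_sq t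
      rcases mul_eq_zero.mp hY with hY | hY
      · rw [sub_eq_zero] at hY
        subst hY
        exact AddSubgroup.mem_zmultiples (T' t)
      · rw [sub_eq_zero] at hY
        subst hY
        obtain ⟨h', e⟩ := neg_T' t
        rw [← e]
        exact neg_mem (AddSubgroup.mem_zmultiples (T' t))
  · rintro ⟨k, rfl⟩
    have h4 : (4 : ℤ) • T' t = 0 := by exact_mod_cast four_nsmul_T' t
    have hk : k • T' t = (k % 4) • T' t := by
      conv_lhs => rw [← Int.emod_add_mul_ediv k 4]
      rw [add_zsmul, mul_comm, mul_zsmul, h4, zsmul_zero, add_zero]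
    change phiHat t (k • T' t) = 0
    rw [hk]
    have h0 := Int.emod_nonneg k (by norm_num : (4 : ℤ) ≠ 0)
    have h1 := Int.emod_lt_of_pos k (by norm_num : (0 : ℤ) < 4)
    obtain h | h | h | h : k % 4 = 0 ∨ k % 4 = 1 ∨ k % 4 = 2 ∨ k % 4 = 3 := by omega
    · rw [h, zero_zsmul]; rfl
    · rw [h, one_zsmul]; exact hT
    · rw [h, two_zsmul, T'_add_T']; exact hD
    · rw [h, show (3 : ℤ) = 4 - 1 from rfl, sub_zsmul, h4, one_zsmul]; simpa using hN

theorem gal_ab (σ : GQ) : σ (ab t) = ab t := σ.commutes _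
theorem gal_Ab (σ : GQ) : σ (Ab t) = Ab t := σ.commutes _
theorem gal_tb (σ : GQ) : σ (tb t) = tb t := σ.commutes _

/-- The dual isogeny is defined over `ℚ`. -/
theorem phiHat_smul (σ : GQ) (P : EPt (E' t)) : phiHat t (σ • P) = σ • phiHat t P := by
  obtain _ | ⟨X, Y, h⟩ := P
  · rfl
  obtain ⟨h', e⟩ := smul_some σ h
  rw [e]
  have e1 : σ X + Ab t = σ (X + Ab t) := by rw [map_add, gal_Ab]
  have e2 : σ X + 2 * Ab t = σ (X + 2 * Ab t) := by
    rw [map_add, map_mul, gal_Ab, map_ofNat]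
  have h2 : σ 2 = 2 := map_ofNat σ 2
  have h4 : σ 4 = 4 := map_ofNat σ 4
  by_cases hX : X + Ab t ≠ 0 ∧ X + 2 * Ab t ≠ 0
  · have hX' : σ X + Ab t ≠ 0 ∧ σ X + 2 * Ab t ≠ 0 := by
      rwa [e1, e2, Ne, Ne, EmbeddingLike.map_eq_zero_iff, EmbeddingLike.map_eq_zero_iff]
    rw [phiHat, phiHat, dif_pos hX, dif_pos hX']
    obtain ⟨h'', e'⟩ := smul_some σ (E_nonsingular_of_equation t
      (isog_equation t (E'_equation_of_nonsingular t h) hX.1 hX.2))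
    rw [e']
    have ex : isogX t (σ X) (σ Y) = σ (isogX t X Y) := by
      simp [isogX, gal_ab, gal_Ab, gal_tb, h2]
    have ey : isogY t (σ X) (σ Y) = σ (isogY t X Y) := by
      simp [isogY, ex, gal_Ab, gal_tb, h2, h4]
    simp only [ex, ey]
  · have hX' : ¬ (σ X + Ab t ≠ 0 ∧ σ X + 2 * Ab t ≠ 0) := by
      rwa [e1, e2, Ne, Ne, EmbeddingLike.map_eq_zero_iff, EmbeddingLike.map_eq_zero_iff]
    rw [phiHat, phiHat, dif_neg hX, dif_neg hX']
    rfl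

/-- The subgroup `E'[φ̂]` of `E'(ℚ̄)`. -/
def kerPhiHat : AddSubgroup (EPt (E' t)) where
  carrier := {P | phiHat t P = 0}
  zero_mem' := rfl
  add_mem' := by
    intro P Q hP hQ
    simp only [Set.mem_ofPred_eq, phiHat_eq_zero_iff] at *
    exact add_mem hP hQ
  neg_mem' := by
    intro P hP
    simp only [Set.mem_ofPred_eq, phiHat_eq_zero_iff] at *
    exact neg_mem hP

instance : DistribMulAction GQ (kerPhiHat t) where
  smul σ P := ⟨σ • P.1, by
    have h : phiHat t P.1 = 0 := P.2
    change phiHat t (σ • P.1) = 0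
    rw [phiHat_smul, h, smul_zero]⟩
  one_smul P := Subtype.ext (one_smul GQ P.1)
  mul_smul σ τ P := Subtype.ext (mul_smul σ τ P.1)
  smul_zero σ := Subtype.ext (smul_zero σ)
  smul_add σ P Q := Subtype.ext (smul_add σ P.1 Q.1)

/-- `T'` as an element of `E'[φ̂]`. -/
def kerT' : kerPhiHat t :=
  ⟨T' t, (phiHat_eq_zero_iff t _).mpr (AddSubgroup.mem_zmultiples _)⟩

theorem four_nsmul_kerT' : 4 • kerT' t = 0 := Subtype.ext (four_nsmul_T' t)

/-! ### The connecting homomorphism `δ_ℚ` -/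

theorem im_ne_neg_im : im ≠ -im := by
  intro h
  exact im_ne_zero (by linear_combination h / 2)

theorem orderOf_im : orderOf im = 4 := by
  have : Fact (Nat.Prime 2) := ⟨Nat.prime_two⟩
  refine orderOf_eq_prime_pow (p := 2) (n := 1) ?_ ?_
  · rw [pow_one, im_sq]
    intro h
    have h2 : (2 : Qbar) = 0 := by linear_combination -h
    norm_num at h2
  · rw [show (2 : ℕ) ^ (1 + 1) = 2 * 2 from rfl, pow_mul, im_sq]
    norm_num

theorem exists_im_pow {ζ : Qbar} (h : ζ ^ 4 = 1) : ∃ m : ℕ, ζ = im ^ m := by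
  have h' : (ζ - 1) * (ζ + 1) * ((ζ - im) * (ζ + im)) = 0 := by
    linear_combination h - (ζ ^ 2 - 1) * im_sq
  rcases mul_eq_zero.mp h' with h' | h' <;> rcases mul_eq_zero.mp h' with h' | h'
  · exact ⟨0, by linear_combination h'⟩
  · exact ⟨2, by linear_combination h' - im_sq⟩
  · exact ⟨1, by linear_combination h'⟩
  · exact ⟨3, by linear_combination h' - im * im_sq⟩

theorem im_pow_nsmul {m n : ℕ} (h : im ^ m = im ^ n) : m • kerT' t = n • kerT' t := by
  have hm : im ^ m ≠ 0 := pow_ne_zero _ im_ne_zero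
  have h' : m ≡ n [MOD 4] := by
    have h1 : (Units.mk0 im im_ne_zero) ^ m = (Units.mk0 im im_ne_zero) ^ n := by
      ext
      simpa using h
    rw [pow_eq_pow_iff_modEq] at h1
    rwa [← orderOf_units, Units.val_mk0, orderOf_im] at h1
  rw [nsmul_eq_nsmul_iff_modEq]
  exact h'.of_dvd (addOrderOf_dvd_of_nsmul_eq_zero (four_nsmul_kerT' t))

open Classical in
/-- An exponent `m` with `ζ = i ^ m`, for a fourth root of unity `ζ`. -/
def logIm (ζ : Qbar) : ℕ := if h : ∃ m : ℕ, ζ = im ^ m then h.choose else 0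

/-- The map `ξ : Gal(ℚ̄/ℚ) → E'[φ̂]`, `ξ_σ = [m] T'` whenever `σ(α) / α = i ^ m`, attached to a
fourth root `α` of a rational number `d ≠ 0`. -/
def kummerFun (α : Qbar) (σ : GQ) : kerPhiHat t := logIm (σ α / α) • kerT' t

theorem kummerFun_eq {α : Qbar} (hα : α ≠ 0) {σ : GQ} {m : ℕ} (h : σ α = im ^ m * α) :
    kummerFun t α σ = m • kerT' t := by
  have h' : σ α / α = im ^ m := by rw [h, mul_div_cancel_right₀ _ hα]
  have hex : ∃ m : ℕ, σ α / α = im ^ m := ⟨m, h'⟩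
  rw [kummerFun, logIm, dif_pos hex]
  apply im_pow_nsmul
  rw [← hex.choose_spec, h']

/-- `α` is a fourth root of the rational number `d`. -/
def IsFourthRoot (d : ℚˣ) (α : Qbar) : Prop := α ^ 4 = algebraMap ℚ Qbar d

theorem IsFourthRoot.ne_zero {d : ℚˣ} {α : Qbar} (h : IsFourthRoot d α) : α ≠ 0 := by
  rintro rfl
  have h' : (0 : Qbar) ^ 4 = algebraMap ℚ Qbar d := h
  rw [zero_pow (by norm_num), eq_comm, map_eq_zero] at h'
  exact d.ne_zero h'

theorem IsFourthRoot.exists_pow {d : ℚˣ} {α β : Qbar} (hα : IsFourthRoot d α)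
    (hβ : IsFourthRoot d β) : ∃ m : ℕ, β = im ^ m * α := by
  have h : (β / α) ^ 4 = 1 := by
    rw [div_pow, div_eq_one_iff_eq (pow_ne_zero _ hα.ne_zero)]
    exact hβ.trans (Eq.symm hα)
  obtain ⟨m, hm⟩ := exists_im_pow h
  exact ⟨m, by rw [← hm, div_mul_cancel₀ _ hα.ne_zero]⟩

theorem IsFourthRoot.gal {d : ℚˣ} {α : Qbar} (hα : IsFourthRoot d α) (σ : GQ) :
    IsFourthRoot d (σ α) := by
  have h : α ^ 4 = algebraMap ℚ Qbar d := hα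
  rw [IsFourthRoot, ← map_pow, h, σ.commutes]

/-- The Galois action on `T'` agrees with that on `i`. -/
theorem smul_kerT' (σ : GQ) : ∃ k : ℕ, σ im = im ^ k ∧ σ • kerT' t = k • kerT' t := by
  have h : (σ im - im) * (σ im + im) = 0 := by
    have h1 : σ im ^ 2 = -1 := by rw [← map_pow, im_sq, map_neg, map_one]
    linear_combination h1 - im_sq
  have h2 : σ 2 = 2 := map_ofNat σ 2
  have h4 : σ 4 = 4 := map_ofNat σ 4
  have hx : σ (-2 * Ab t) = -2 * Ab t := by rw [map_mul, map_neg, h2, gal_Ab]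
  obtain ⟨h', e⟩ := smul_some σ (T'_nonsingular t)
  rcases mul_eq_zero.mp h with h | h
  · have hi : σ im = im := by linear_combination h
    refine ⟨1, by rw [hi, pow_one], ?_⟩
    rw [one_nsmul]
    refine Subtype.ext (e.trans ?_)
    have hy : σ (Ab t * (2 + im * tb t) / 4) = Ab t * (2 + im * tb t) / 4 := by
      simp [gal_Ab, gal_tb, h2, h4, hi]
    simp only [hx, hy]
    rfl
  · have hi : σ im = -im := by linear_combination h
    refine ⟨3, by rw [hi]; linear_combination -im * im_sq, ?_⟩
    have h3 : (3 : ℕ) • kerT' t = -kerT' t := by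
      have := four_nsmul_kerT' t
      rw [show (4 : ℕ) = 3 + 1 from rfl, add_nsmul, one_nsmul] at this
      exact eq_neg_of_add_eq_zero_left this
    rw [h3]
    refine Subtype.ext (e.trans ?_)
    obtain ⟨h'', e''⟩ := neg_T' t
    have hy : σ (Ab t * (2 + im * tb t) / 4) = Ab t * (2 - im * tb t) / 4 := by
      simp [gal_Ab, gal_tb, h2, h4, hi, sub_eq_add_neg]
    change _ = -T' t
    rw [e'']
    simp only [hx, hy]

/-- The crossed homomorphism `ξ` attached to a fourth root `α` of `d`. -/
def kummerCocycle {d : ℚˣ} {α : Qbar} (hα : IsFourthRoot d α) : Z1 (kerPhiHat t) :=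
  ⟨kummerFun t α, (isLocallyConstant_apply α).comp (fun x => logIm (x / α) • kerT' t),
    fun σ τ => by
      obtain ⟨m, hm⟩ := hα.exists_pow (hα.gal σ)
      obtain ⟨n, hn⟩ := hα.exists_pow (hα.gal τ)
      obtain ⟨k, hk, hk'⟩ := smul_kerT' t σ
      have h : (σ * τ) α = im ^ (m + k * n) * α := by
        rw [AlgEquiv.mul_apply, hn, map_mul, map_pow, hk, hm]
        ring
      rw [kummerFun_eq t hα.ne_zero hm, kummerFun_eq t hα.ne_zero hn,
        kummerFun_eq t hα.ne_zero h, gal_nsmul, hk', add_nsmul, mul_nsmul]⟩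

theorem kummerCocycle_class_eq {d : ℚˣ} {α β : Qbar} (hα : IsFourthRoot d α)
    (hβ : IsFourthRoot d β) :
    (QuotientAddGroup.mk (kummerCocycle t hα) : H1 (kerPhiHat t)) =
      QuotientAddGroup.mk (kummerCocycle t hβ) := by
  rw [QuotientAddGroup.eq]
  obtain ⟨n, rfl⟩ := hα.exists_pow hβ
  refine ⟨n • kerT' t, fun σ => ?_⟩
  change -kummerFun t α σ + kummerFun t (im ^ n * α) σ = _
  obtain ⟨m, hm⟩ := hα.exists_pow (hα.gal σ)
  obtain ⟨k, hk, hk'⟩ := smul_kerT' t σ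
  have h4 : im ^ (3 * n) * im ^ n = 1 := by
    rw [← pow_add, show 3 * n + n = 4 * n by ring, pow_mul, ← orderOf_im, pow_orderOf_eq_one,
      one_pow]
  have h : σ (im ^ n * α) = im ^ (m + k * n + 3 * n) * (im ^ n * α) := by
    rw [map_mul, map_pow, hk, hm, pow_add _ _ (3 * n)]
    linear_combination -(im ^ (m + k * n) * α) * h4
  rw [kummerFun_eq t hα.ne_zero hm, kummerFun_eq t hβ.ne_zero h, gal_nsmul, hk', add_nsmul,
    add_nsmul, mul_nsmul, mul_nsmul]
  have h3 : n • 3 • kerT' t = -(n • kerT' t) := by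
    have h5 := four_nsmul_kerT' t
    rw [show (4 : ℕ) = 3 + 1 from rfl, add_nsmul, one_nsmul] at h5
    rw [eq_neg_of_add_eq_zero_left h5, smul_neg]
  rw [h3]
  abel

/-- A fourth root `⁴√d` in `ℚ̄`. -/
def fourthRoot (d : ℚˣ) : Qbar :=
  Classical.choose (IsAlgClosed.exists_pow_nat_eq (algebraMap ℚ Qbar d) four_pos)

theorem fourthRoot_spec (d : ℚˣ) : IsFourthRoot d (fourthRoot d) :=
  Classical.choose_spec (IsAlgClosed.exists_pow_nat_eq (algebraMap ℚ Qbar d) four_pos)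

/-- `d ↦ {ξ}` as a homomorphism from `ℚ^×`. -/
def kummerHom : ℚˣ →* Multiplicative (H1 (kerPhiHat t)) :=
  MonoidHom.mk' (fun d =>
    Multiplicative.ofAdd (QuotientAddGroup.mk (kummerCocycle t (fourthRoot_spec d)))) (by
    intro c d
    have hc := fourthRoot_spec c
    have hd := fourthRoot_spec d
    have hcd : IsFourthRoot (c * d) (fourthRoot c * fourthRoot d) := by
      rw [IsFourthRoot, mul_pow, Units.val_mul, map_mul]
      exact congrArg₂ (· * ·) hc hd
    rw [kummerCocycle_class_eq t (fourthRoot_spec (c * d)) hcd, ← ofAdd_add,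
      ← QuotientAddGroup.mk_add]
    congr 2
    refine Subtype.ext (funext fun σ => ?_)
    change kummerFun t (fourthRoot c * fourthRoot d) σ =
      kummerFun t (fourthRoot c) σ + kummerFun t (fourthRoot d) σ
    obtain ⟨m, hm⟩ := hc.exists_pow (hc.gal σ)
    obtain ⟨n, hn⟩ := hd.exists_pow (hd.gal σ)
    rw [kummerFun_eq t hc.ne_zero hm, kummerFun_eq t hd.ne_zero hn, ← add_nsmul]
    apply kummerFun_eq t hcd.ne_zero
    rw [map_mul, hm, hn]
    ring)

/-- The subgroup `(ℚ^×)⁴` of `ℚ^×`. -/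
abbrev fourthPowers : Subgroup ℚˣ := (powMonoidHom 4 : ℚˣ →* ℚˣ).range

/-- The connecting homomorphism `δ_ℚ : ℚ^× / (ℚ^×)⁴ → H¹(Gal(ℚ̄/ℚ), E'[φ̂])`, `d ↦ {ξ}`. -/
def deltaQ : ℚˣ ⧸ fourthPowers →* Multiplicative (H1 (kerPhiHat t)) :=
  QuotientGroup.lift fourthPowers (kummerHom t) (by
    rintro _ ⟨c, rfl⟩
    have hc : IsFourthRoot (powMonoidHom 4 c) (algebraMap ℚ Qbar c) := by
      simp [IsFourthRoot]
    change Multiplicative.ofAdd (QuotientAddGroup.mk (kummerCocycle t (fourthRoot_spec _))) = _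
    rw [kummerCocycle_class_eq t (fourthRoot_spec _) hc, ofAdd_eq_one,
      QuotientAddGroup.eq_zero_iff]
    refine ⟨0, fun σ => ?_⟩
    change kummerFun t (algebraMap ℚ Qbar c) σ = _
    rw [kummerFun_eq t hc.ne_zero (m := 0) (by rw [σ.commutes, pow_zero, one_mul])]
    simp)

/-- The composite `ℚ^× / (ℚ^×)⁴ → H¹(Gal(ℚ̄/ℚ), E'[φ̂]) → H¹(Gal(ℚ̄/ℚ), E')` of `δ_ℚ` with the
map induced by the inclusion `E'[φ̂] ⊆ E'`. -/
def deltaE' (d : ℚˣ ⧸ fourthPowers) : H1 (EPt (E' t)) :=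
  H1.map (kerPhiHat t).subtype (fun _ _ => rfl) (Multiplicative.toAdd (deltaQ t d))

/-! ### The curve `C'_d` -/

variable (d : ℚˣ)

/-- The image of `d` in `ℚ̄`. -/
def db : Qbar := algebraMap ℚ Qbar d

/-- The affine equation `d (w + a z²) z² = (w² - d)²` of `C'_d`. -/
def OnC' (z w : Qbar) : Prop := db d * (w + ab t * z ^ 2) * z ^ 2 = (w ^ 2 - db d) ^ 2

open MvPolynomial in
/-- The plane curve `d (w + a z²) z² = (w² - d)²` is singular at the two points `(0, ±√d)`, so
`C'_d` is its smooth projective model.  With `u = (w² - d) / z` this is the complete intersection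
`u z = w² - d s²`, `u² = d w s + d a z²` of two quadrics in the projective space with coordinates
`[z : w : u : s]`, which is smooth; see `onC'_iff_exists` for its relation with the plane curve. -/
def C' : ProjVar 3 where
  eqs := {X 2 * X 0 - X 1 ^ 2 + C (d : ℚ) * X 3 ^ 2,
    X 2 ^ 2 - C (d : ℚ) * (X 1 * X 3) - C ((d : ℚ) * a t) * X 0 ^ 2}
  homogeneous := by
    have hX : ∀ i : Fin 4, (X i : MvPolynomial (Fin 4) ℚ).IsHomogeneous 1 := isHomogeneous_X ℚ
    have hm : ∀ i j : Fin 4, (X i * X j : MvPolynomial (Fin 4) ℚ).IsHomogeneous 2 :=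
      fun i j => (hX i).mul (hX j)
    have hc : ∀ (c : ℚ) (F : MvPolynomial (Fin 4) ℚ), F.IsHomogeneous 2 →
        (C c * F).IsHomogeneous 2 := fun c F hF => by
      simpa using (isHomogeneous_C (Fin 4) c).mul hF
    rintro F (rfl | rfl)
    · refine ⟨2, ?_⟩
      rw [sq, sq]
      exact ((hm 2 0).sub (hm 1 1)).add (hc _ _ (hm 3 3))
    · refine ⟨2, ?_⟩
      rw [sq, sq]
      exact ((hm 2 2).sub (hc _ _ (hm 1 3))).sub (hc _ _ (hm 0 0))

theorem C'_contains_mk (v : Fin 4 → Qbar) (hv : v ≠ 0) :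
    (C' t d).Contains (Projectivization.mk Qbar v hv) ↔
      v 2 * v 0 = v 1 ^ 2 - db d * v 3 ^ 2 ∧
      v 2 ^ 2 = db d * v 1 * v 3 + db d * ab t * v 0 ^ 2 := by
  have h := (C' t d).contains_mk v hv
  rw [h]
  simp only [C', Set.mem_insert_iff, Set.mem_singleton_iff, forall_eq_or_imp, forall_eq, map_add,
    map_sub, map_mul, map_pow, MvPolynomial.aeval_X, MvPolynomial.aeval_C]
  rw [show algebraMap ℚ Qbar (d : ℚ) = db d from rfl,
    show algebraMap ℚ Qbar (a t) = ab t from rfl]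
  constructor
  · rintro ⟨h1, h2⟩
    exact ⟨by linear_combination h1, by linear_combination h2⟩
  · rintro ⟨h1, h2⟩
    exact ⟨by linear_combination h1, by linear_combination h2⟩

/-- The point of `C'_d` with affine coordinates `(z, w)`, `z ≠ 0`. -/
def C'.pt {z w : Qbar} (h : OnC' t d z w) (hz : z ≠ 0) : (C' t d).Pt :=
  ⟨Projectivization.mk Qbar (![z, w, (w ^ 2 - db d) / z, 1] : Fin 4 → Qbar)
      (fun h0 => one_ne_zero (congrFun h0 3)), by
    rw [OnC'] at h
    refine (C'_contains_mk t d _ _).mpr ⟨?_, ?_⟩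
    · simp only [Matrix.cons_val]
      field_simp
    · simp only [Matrix.cons_val]
      rw [div_pow, div_eq_iff (pow_ne_zero _ hz)]
      linear_combination -h⟩

/-- `(z, w) ↦ [z : w : (w² - d) / z : 1]` is injective on the plane curve (where `z ≠ 0`). -/
theorem C'.pt_injective {z w z' w' : Qbar} (h : OnC' t d z w) (hz : z ≠ 0)
    (h' : OnC' t d z' w') (hz' : z' ≠ 0) (e : C'.pt t d h hz = C'.pt t d h' hz') :
    z = z' ∧ w = w' := by
  have e1 := congrArg Subtype.val e
  obtain ⟨c, hc⟩ := (Projectivization.mk_eq_mk_iff' Qbar _ _ _ _).mp e1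
  have h3 := congrFun hc 3
  have h0 := congrFun hc 0
  have h1 := congrFun hc 1
  simp only [Pi.smul_apply, smul_eq_mul, Matrix.cons_val] at h0 h1 h3
  rw [mul_one] at h3
  subst h3
  exact ⟨by rw [← h0, one_mul], by rw [← h1, one_mul]⟩

/-- The image of `(z, w) ↦ [z : w : (w² - d) / z : 1]` is the open part `z ≠ 0`, `s ≠ 0`. -/
theorem onC'_iff_exists (v : Fin 4 → Qbar) (hv : v ≠ 0)
    (h : (C' t d).Contains (Projectivization.mk Qbar v hv)) :
    (v 0 ≠ 0 ∧ v 3 ≠ 0) ↔ ∃ (z w : Qbar) (hzw : OnC' t d z w) (hz : z ≠ 0),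
      (⟨Projectivization.mk Qbar v hv, h⟩ : (C' t d).Pt) = C'.pt t d hzw hz := by
  constructor
  · rintro ⟨h0, h3⟩
    obtain ⟨e1, e2⟩ := (C'_contains_mk t d v hv).mp h
    have hu : v 2 / v 3 * (v 0 / v 3) = (v 1 / v 3) ^ 2 - db d := by
      field_simp
      linear_combination e1
    refine ⟨v 0 / v 3, v 1 / v 3, ?_, div_ne_zero h0 h3, Subtype.ext ?_⟩
    · rw [OnC', ← hu]
      field_simp
      linear_combination -e2
    · refine (Projectivization.mk_eq_mk_iff' Qbar _ _ _ _).mpr ⟨v 3, ?_⟩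
      have hu' : ((v 1 / v 3) ^ 2 - db d) / (v 0 / v 3) = v 2 / v 3 := by
        rw [← hu, mul_div_cancel_right₀ _ (div_ne_zero h0 h3)]
      rw [hu']
      ext i
      fin_cases i <;> simp [mul_div_cancel₀, h3]
  · rintro ⟨z, w, hzw, hz, e⟩
    obtain ⟨c, hc⟩ := (Projectivization.mk_eq_mk_iff' Qbar _ _ _ _).mp (congrArg Subtype.val e)
    have hc0 : c ≠ 0 := by
      rintro rfl
      rw [zero_smul] at hc
      exact hv hc.symm
    have h3 := congrFun hc 3
    have h0 := congrFun hc 0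
    simp only [Pi.smul_apply, smul_eq_mul, Matrix.cons_val] at h0 h3
    rw [← h0, ← h3]
    exact ⟨mul_ne_zero hc0 hz, by simpa using hc0⟩

end Curves

end FourDescent

end

/-!
The curve `C'_1` is isomorphic to `E'` over `ℚ`. With `p = (2Y + X + A) / (2t(X + A))` and
`q = X / (4(X + 2A))` the equation of `E'` becomes `p² - q² = 16p²q² - a`, and
`[z : w : u : s] = [1 : p + q : 4pq : p - q]` satisfies `uz = w² - s²`, `u² = ws + az²`. This is the
map `psi`; it is bijective, commutes with the Galois action, and it and its inverse are given
locally by forms without common zeros (`regularAt_psiEquiv`, `regularAt_psiEquiv_symm`). In these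
coordinates `φ̂` is `(u² / z² - a, (u² / z² - a)² - s⁴ / z⁴)`.

If `α⁴ = d`, then `(z, w) ↦ (z / α, w / α²)` is an isomorphism from `C'_d` to `C'_1`, and `θ` is its
composite with the inverse of `psi`. The formula for `φ̂ ∘ θ` results from the equation of `C'_d`
(`phiHat_theta`).

Translation by `T'` on `E'` is `(p, q) ↦ (-iq, -ip)`, that is, `(z, w) ↦ (-iz, -w)` on `C'_1`
(`vecC_add_T'`). Hence, if `σ(α) = iᵐ α`, then `θ(σp) = σ(θ(p)) - mT'` (`theta_smul`). It follows
that the action `p + P = θ⁻¹(θ(p) - P)` is defined over `ℚ`, and that `σ(p₀) - p₀ = mT'` for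
`p₀ = θ⁻¹(0)`, which is the cocycle defining `δ_ℚ(d)`.

It remains to see that the action and the difference map are morphisms and that the class in `H¹`
determines the homogeneous space. The first reduces to subtraction on `E'`. The addition formulas of
bidegree `(2, 2)` compute `P + Q` when `P ≠ Q`; the other pairs are reached by composing with
translations, the points `T'` and `2T'` leaving enough room (`regularAt₂_add`). For the second,
if the cocycles of two homogeneous spaces with base points `p` and `q` agree, then
`x ↦ q + (x - p)` is an equivalence defined over `ℚ`, and a coboundary is absorbed by moving a base
point (`WC.toH1_injective`).
-/

noncomputable section

namespace FourDescent

/-! ### Regular maps: evaluation on representing vectors, composition, slices -/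

open MvPolynomial

theorem IsWeightedHomogeneous.eval_scale {σ : Type*} {w : σ → ℕ} {F : MvPolynomial σ Qbar} {k : ℕ}
    (hF : F.IsWeightedHomogeneous w k) (c : Qbar) (v : σ → Qbar) :
    eval (fun i => c ^ w i * v i) F = c ^ k * eval v F := by
  rw [eval_eq, eval_eq, Finset.mul_sum]
  refine Finset.sum_congr rfl fun m hm => ?_
  have hk : ∑ i ∈ m.support, w i * m i = k := by
    rw [← hF (mem_support_iff.mp hm), Finsupp.weight_apply, Finsupp.sum]
    simp [mul_comm]
  simp only [mul_pow, Finset.prod_mul_distrib, ← pow_mul, Finset.prod_pow_eq_pow_sum, hk]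
  ring

theorem IsWeightedHomogeneous.aeval {σ τ : Type*} {w : σ → ℕ} {w' : τ → ℕ}
    {F : MvPolynomial σ Qbar} {G : σ → MvPolynomial τ Qbar} {k n : ℕ}
    (hF : F.IsWeightedHomogeneous w k) (hG : ∀ i, (G i).IsWeightedHomogeneous w' (w i * n)) :
    (aeval G F).IsWeightedHomogeneous w' (k * n) := by
  rw [aeval_def, eval₂_eq]
  refine IsWeightedHomogeneous.sum _ _ _ fun m hm => ?_
  have hk : ∑ i ∈ m.support, m i * (w i * n) = k * n := by
    rw [← hF (mem_support_iff.mp hm), Finsupp.weight_apply, Finsupp.sum, Finset.sum_mul]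
    simp [mul_assoc]
  rw [← hk]
  refine IsWeightedHomogeneous.C_mul (IsWeightedHomogeneous.prod _ _ _ fun i _ => ?_) _
  simpa using (hG i).pow (m i)

theorem rename_eq_aeval {σ τ : Type*} (f : σ → τ) (F : MvPolynomial σ Qbar) :
    rename f F = aeval (fun i => (X (f i) : MvPolynomial τ Qbar)) F := by
  have h := aeval_rename f (X : τ → MvPolynomial τ Qbar) F
  rwa [aeval_X_left_apply] at h

theorem eval_aeval {σ τ : Type*} (v : τ → Qbar) (G : σ → MvPolynomial τ Qbar)
    (F : MvPolynomial σ Qbar) : eval v (aeval G F) = eval (fun i => eval v (G i)) F := by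
  rw [← coe_aeval_eq_eval, ← coe_aeval_eq_eval]
  simp only [RingHom.coe_coe]
  rw [← AlgHom.comp_apply, comp_aeval]

theorem eval_smul_of_isHomogeneous {σ : Type*} {F : MvPolynomial σ Qbar} {k : ℕ}
    (hF : F.IsHomogeneous k) (c : Qbar) (v : σ → Qbar) :
    eval (c • v) F = c ^ k * eval v F := by
  have h := IsWeightedHomogeneous.eval_scale (w := 1) hF c v
  simp only [Pi.one_apply, pow_one] at h
  exact h

theorem IsBihomogeneous.eval_smul {α β : Type} {F : MvPolynomial (α ⊕ β) Qbar} {k l : ℕ}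
    (hF : IsBihomogeneous F k l) (c e : Qbar) (v : α → Qbar) (w : β → Qbar) :
    eval (Sum.elim (c • v) (e • w)) F = c ^ k * e ^ l * eval (Sum.elim v w) F := by
  have h1 := IsWeightedHomogeneous.eval_scale hF.1 c (Sum.elim v (e • w))
  have h2 := IsWeightedHomogeneous.eval_scale hF.2 e (Sum.elim v w)
  have e1 : (fun i => c ^ (Sum.elim (fun _ => 1) (fun _ => 0) : α ⊕ β → ℕ) i *
      Sum.elim v (e • w) i) = Sum.elim (c • v) (e • w) := by
    ext i; cases i <;> simp
  have e2 : (fun i => e ^ (Sum.elim (fun _ => 0) (fun _ => 1) : α ⊕ β → ℕ) i *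
      Sum.elim v w i) = Sum.elim v (e • w) := by
    ext i; cases i <;> simp
  rw [e1] at h1
  rw [e2] at h2
  rw [h1, h2, mul_assoc]

/-- `f` is regular at `x₀`: homogeneous polynomials of the same degree, not all vanishing at `x₀`,
compute a multiple (possibly zero) of the coordinates of `f x` at every point `x`.  Allowing the
multiple `0` makes this notion stable under substitution without any case distinction. -/
def RegularAt {X Y : Type} {m n : ℕ} (ι : X → ProjSpace m) (κ : Y → ProjSpace n)
    (f : X → Y) (x₀ : X) : Prop :=
  ∃ (k : ℕ) (F : Fin (n + 1) → MvPolynomial (Fin (m + 1)) Qbar),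
    (∀ j, (F j).IsHomogeneous k) ∧
    (fun j => eval (ι x₀).rep (F j)) ≠ 0 ∧
    ∀ x, ∃ c : Qbar, (fun j => eval (ι x).rep (F j)) = c • (κ (f x)).rep

/-- The analogue of `RegularAt` for maps from a product. -/
def RegularAt₂ {X Y Z : Type} {l m n : ℕ} (ι : X → ProjSpace l) (κ : Y → ProjSpace m)
    (lam : Z → ProjSpace n) (f : X → Y → Z) (x₀ : X) (y₀ : Y) : Prop :=
  ∃ (k₁ k₂ : ℕ) (F : Fin (n + 1) → MvPolynomial (Fin (l + 1) ⊕ Fin (m + 1)) Qbar),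
    (∀ j, IsBihomogeneous (F j) k₁ k₂) ∧
    (fun j => eval (Sum.elim (ι x₀).rep (κ y₀).rep) (F j)) ≠ 0 ∧
    ∀ x y, ∃ c : Qbar,
      (fun j => eval (Sum.elim (ι x).rep (κ y).rep) (F j)) = c • (lam (f x y)).rep

/-- `v` is a multiple of a representative of `p` if and only if it represents `p` when nonzero. -/
theorem exists_smul_rep_iff {n : ℕ} (p : ProjSpace n) (v : Fin (n + 1) → Qbar) :
    (∃ c : Qbar, v = c • p.rep) ↔ ∀ h : v ≠ 0, p = Projectivization.mk Qbar v h := by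
  constructor
  · rintro ⟨c, rfl⟩ h
    conv_lhs => rw [← p.mk_rep]
    have hc : c ≠ 0 := by rintro rfl; simp at h
    exact (Projectivization.mk_eq_mk_iff' Qbar _ _ _ _).mpr
      ⟨c⁻¹, by rw [smul_smul, inv_mul_cancel₀ hc, one_smul]⟩
  · intro h
    by_cases hv : v = 0
    · exact ⟨0, by rw [hv, zero_smul]⟩
    · have := h hv
      conv_lhs at this => rw [← p.mk_rep]
      obtain ⟨c, hc⟩ := (Projectivization.mk_eq_mk_iff' Qbar _ _ _ _).mp this.symm
      exact ⟨c, hc.symm⟩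

/-- `IsRegular` imposes a condition at `x` only when the polynomials do not all vanish there;
`RegularAt` expresses this by admitting the multiple `0`. -/
theorem isRegular_iff {X Y : Type} {m n : ℕ} {ι : X → ProjSpace m} {κ : Y → ProjSpace n}
    {f : X → Y} : IsRegular ι κ f ↔ ∀ x₀, RegularAt ι κ f x₀ := by
  simp only [IsRegular, RegularAt, exists_smul_rep_iff]

theorem isRegular₂_iff {X Y Z : Type} {l m n : ℕ} {ι : X → ProjSpace l} {κ : Y → ProjSpace m}
    {lam : Z → ProjSpace n} {f : X → Y → Z} :
    IsRegular₂ ι κ lam f ↔ ∀ x₀ y₀, RegularAt₂ ι κ lam f x₀ y₀ := by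
  simp only [IsRegular₂, RegularAt₂, exists_smul_rep_iff]

section Composition

variable {S X Y Z Z' : Type} {k l m n n' : ℕ} {η : S → ProjSpace k} {ι : X → ProjSpace l}
  {κ : Y → ProjSpace m} {lam : Z → ProjSpace n} {lam' : Z' → ProjSpace n'}

theorem smul_ne_zero_of_eq {n : ℕ} {v w : Fin (n + 1) → Qbar} {c : Qbar} (h : v = c • w)
    (hv : v ≠ 0) : c ≠ 0 := by
  rintro rfl
  exact hv (by rw [h, zero_smul])

theorem RegularAt.comp {g : Y → Z} {f : X → Y} {x₀ : X} (hg : RegularAt κ lam g (f x₀))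
    (hf : RegularAt ι κ f x₀) : RegularAt ι lam (fun x => g (f x)) x₀ := by
  obtain ⟨a, F, hF, hF0, hFx⟩ := hf
  obtain ⟨b, G, hG, hG0, hGx⟩ := hg
  have key : ∀ x, ∃ c : Qbar, (fun j => eval (ι x).rep (F j)) = c • (κ (f x)).rep ∧
      (fun j => eval (ι x).rep (aeval F (G j))) =
        c ^ b • (fun j => eval (κ (f x)).rep (G j)) := by
    intro x
    obtain ⟨c, hc⟩ := hFx x
    refine ⟨c, hc, funext fun j => ?_⟩
    rw [eval_aeval, hc, eval_smul_of_isHomogeneous (hG j)]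
    rfl
  refine ⟨_, fun j => aeval F (G j), fun j => (hG j).aeval _ hF, ?_, fun x => ?_⟩
  · obtain ⟨c, hc, e⟩ := key x₀
    rw [e]
    exact smul_ne_zero (pow_ne_zero _ (smul_ne_zero_of_eq hc hF0)) hG0
  · obtain ⟨c, hc, e⟩ := key x
    obtain ⟨c', hc'⟩ := hGx (f x)
    exact ⟨c ^ b * c', by rw [e, hc', smul_smul]⟩

theorem RegularAt.comp₂ {g : Z → Z'} {f : X → Y → Z} {x₀ : X} {y₀ : Y}
    (hg : RegularAt lam lam' g (f x₀ y₀)) (hf : RegularAt₂ ι κ lam f x₀ y₀) :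
    RegularAt₂ ι κ lam' (fun x y => g (f x y)) x₀ y₀ := by
  obtain ⟨a₁, a₂, F, hF, hF0, hFx⟩ := hf
  obtain ⟨b, G, hG, hG0, hGx⟩ := hg
  have key : ∀ x y, ∃ c : Qbar,
      (fun j => eval (Sum.elim (ι x).rep (κ y).rep) (F j)) = c • (lam (f x y)).rep ∧
      (fun j => eval (Sum.elim (ι x).rep (κ y).rep) (aeval F (G j))) =
        c ^ b • (fun j => eval (lam (f x y)).rep (G j)) := by
    intro x y
    obtain ⟨c, hc⟩ := hFx x y
    refine ⟨c, hc, funext fun j => ?_⟩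
    rw [eval_aeval, hc, eval_smul_of_isHomogeneous (hG j)]
    rfl
  refine ⟨b * a₁, b * a₂, fun j => aeval F (G j), fun j =>
    ⟨IsWeightedHomogeneous.aeval (w := 1) (hG j) (fun i => by simpa using (hF i).1),
      IsWeightedHomogeneous.aeval (w := 1) (hG j) (fun i => by simpa using (hF i).2)⟩,
    ?_, fun x y => ?_⟩
  · obtain ⟨c, hc, e⟩ := key x₀ y₀
    rw [e]
    exact smul_ne_zero (pow_ne_zero _ (smul_ne_zero_of_eq hc hF0)) hG0
  · obtain ⟨c, hc, e⟩ := key x y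
    obtain ⟨c', hc'⟩ := hGx (f x y)
    exact ⟨c ^ b * c', by rw [e, hc', smul_smul]⟩

theorem isBihomogeneous_rename_inl {F : MvPolynomial (Fin (k + 1)) Qbar} {a : ℕ}
    (hF : F.IsHomogeneous a) : IsBihomogeneous (β := Fin (l + 1)) (rename Sum.inl F) a 0 := by
  rw [rename_eq_aeval]
  have h1 := IsWeightedHomogeneous.aeval (w := 1) (n := 1) hF fun i => isWeightedHomogeneous_X Qbar
    (Sum.elim (fun _ => 1) (fun _ => 0) : Fin (k + 1) ⊕ Fin (l + 1) → ℕ) (Sum.inl i)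
  have h2 := IsWeightedHomogeneous.aeval (w := 1) (n := 0) hF fun i => isWeightedHomogeneous_X Qbar
    (Sum.elim (fun _ => 0) (fun _ => 1) : Fin (k + 1) ⊕ Fin (l + 1) → ℕ) (Sum.inl i)
  rw [mul_one] at h1
  exact ⟨h1, h2⟩

theorem isBihomogeneous_rename_inr {F : MvPolynomial (Fin (k + 1)) Qbar} {a : ℕ}
    (hF : F.IsHomogeneous a) : IsBihomogeneous (α := Fin (l + 1)) (rename Sum.inr F) 0 a := by
  rw [rename_eq_aeval]
  have h1 := IsWeightedHomogeneous.aeval (w := 1) (n := 0) hF fun i => isWeightedHomogeneous_X Qbar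
    (Sum.elim (fun _ => 1) (fun _ => 0) : Fin (l + 1) ⊕ Fin (k + 1) → ℕ) (Sum.inr i)
  have h2 := IsWeightedHomogeneous.aeval (w := 1) (n := 1) hF fun i => isWeightedHomogeneous_X Qbar
    (Sum.elim (fun _ => 0) (fun _ => 1) : Fin (l + 1) ⊕ Fin (k + 1) → ℕ) (Sum.inr i)
  rw [mul_one] at h2
  exact ⟨h1, h2⟩

theorem RegularAt₂.comp {S' : Type} {k' : ℕ} {η' : S' → ProjSpace k'} {f : X → Y → Z} {g : S → X}
    {h : S' → Y} {s₀ : S} {r₀ : S'} (hf : RegularAt₂ ι κ lam f (g s₀) (h r₀))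
    (hg : RegularAt η ι g s₀) (hh : RegularAt η' κ h r₀) :
    RegularAt₂ η η' lam (fun s r => f (g s) (h r)) s₀ r₀ := by
  obtain ⟨a₁, a₂, F, hF, hF0, hFx⟩ := hf
  obtain ⟨b, G, hG, hG0, hGx⟩ := hg
  obtain ⟨c, H, hH, hH0, hHx⟩ := hh
  set K : Fin (l + 1) ⊕ Fin (m + 1) → MvPolynomial (Fin (k + 1) ⊕ Fin (k' + 1)) Qbar :=
    Sum.elim (fun i => rename Sum.inl (G i)) (fun i => rename Sum.inr (H i)) with hK
  have key : ∀ s r, ∃ u v : Qbar,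
      (fun j => eval (η s).rep (G j)) = u • (ι (g s)).rep ∧
      (fun j => eval (η' r).rep (H j)) = v • (κ (h r)).rep ∧
      (fun j => eval (Sum.elim (η s).rep (η' r).rep) (aeval K (F j))) =
        (u ^ a₁ * v ^ a₂) • (fun j => eval (Sum.elim (ι (g s)).rep (κ (h r)).rep) (F j)) := by
    intro s r
    obtain ⟨u, hu⟩ := hGx s
    obtain ⟨v, hv⟩ := hHx r
    refine ⟨u, v, hu, hv, funext fun j => ?_⟩
    have e : (fun i => eval (Sum.elim (η s).rep (η' r).rep) (K i)) =
        Sum.elim (u • (ι (g s)).rep) (v • (κ (h r)).rep) := by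
      ext i
      cases i with
      | inl i => simp [hK, eval_rename, ← hu]
      | inr i => simp [hK, eval_rename, ← hv]
    rw [eval_aeval, e, (hF j).eval_smul]
    rfl
  refine ⟨a₁ * b, a₂ * c, fun j => aeval K (F j), fun j =>
    ⟨IsWeightedHomogeneous.aeval (hF j).1 ?_, IsWeightedHomogeneous.aeval (hF j).2 ?_⟩,
    ?_, fun s r => ?_⟩
  · rintro (i | i)
    · simpa [hK] using (isBihomogeneous_rename_inl (hG i)).1
    · simpa [hK] using (isBihomogeneous_rename_inr (hH i)).1
  · rintro (i | i)
    · simpa [hK] using (isBihomogeneous_rename_inl (hG i)).2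
    · simpa [hK] using (isBihomogeneous_rename_inr (hH i)).2
  · obtain ⟨u, v, hu, hv, e⟩ := key s₀ r₀
    rw [e]
    exact smul_ne_zero (mul_ne_zero (pow_ne_zero _ (smul_ne_zero_of_eq hu hG0))
      (pow_ne_zero _ (smul_ne_zero_of_eq hv hH0))) hF0
  · obtain ⟨u, v, hu, hv, e⟩ := key s r
    obtain ⟨c', hc'⟩ := hFx (g s) (h r)
    exact ⟨u ^ a₁ * v ^ a₂ * c', by rw [e, hc', smul_smul]⟩

theorem RegularAt₂.swap {f : X → Y → Z} {x₀ : X} {y₀ : Y} (hf : RegularAt₂ ι κ lam f x₀ y₀) :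
    RegularAt₂ κ ι lam (fun y x => f x y) y₀ x₀ := by
  obtain ⟨a₁, a₂, F, hF, hF0, hFx⟩ := hf
  have key : ∀ x y j, eval (Sum.elim (κ y).rep (ι x).rep) (rename Sum.swap (F j)) =
      eval (Sum.elim (ι x).rep (κ y).rep) (F j) := by
    intro x y j
    rw [eval_rename]
    congr 2
    ext i
    cases i <;> rfl
  refine ⟨a₂, a₁, fun j => rename Sum.swap (F j), fun j => ⟨?_, ?_⟩, ?_, fun y x => ?_⟩
  · have h := IsWeightedHomogeneous.aeval (n := 1) (G := fun i => MvPolynomial.X (Sum.swap i))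
      (w' := Sum.elim (fun _ => 1) (fun _ => 0)) (hF j).2
      (by rintro (i | i) <;> exact isWeightedHomogeneous_X Qbar _ _)
    rwa [mul_one, ← rename_eq_aeval] at h
  · have h := IsWeightedHomogeneous.aeval (n := 1) (G := fun i => MvPolynomial.X (Sum.swap i))
      (w' := Sum.elim (fun _ => 0) (fun _ => 1)) (hF j).1
      (by rintro (i | i) <;> exact isWeightedHomogeneous_X Qbar _ _)
    rwa [mul_one, ← rename_eq_aeval] at h
  · simpa only [key] using hF0
  · simpa only [key] using hFx x y

/-- Specializing the second argument. -/
theorem RegularAt₂.left {f : X → Y → Z} {x₀ : X} {y₀ : Y} (hf : RegularAt₂ ι κ lam f x₀ y₀) :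
    RegularAt ι lam (fun x => f x y₀) x₀ := by
  obtain ⟨a₁, a₂, F, hF, hF0, hFx⟩ := hf
  have key : ∀ x j, eval (ι x).rep (aeval (Sum.elim MvPolynomial.X
      (fun i => MvPolynomial.C ((κ y₀).rep i))) (F j)) =
      eval (Sum.elim (ι x).rep (κ y₀).rep) (F j) := by
    intro x j
    rw [eval_aeval]
    congr 2
    ext i
    cases i <;> simp
  refine ⟨a₁, fun j => aeval (Sum.elim MvPolynomial.X
      (fun i => MvPolynomial.C ((κ y₀).rep i))) (F j), fun j => ?_, ?_, fun x => ?_⟩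
  · have := IsWeightedHomogeneous.aeval (n := 1) (w' := 1) (hF j).1 (G := Sum.elim MvPolynomial.X
      (fun i => MvPolynomial.C ((κ y₀).rep i))) (by
        rintro (i | i)
        · exact isWeightedHomogeneous_X Qbar 1 i
        · exact isWeightedHomogeneous_C 1 _)
    rwa [mul_one] at this
  · simpa only [key] using hF0
  · simpa only [key] using hFx x y₀

theorem RegularAt₂.right {f : X → Y → Z} {x₀ : X} {y₀ : Y} (hf : RegularAt₂ ι κ lam f x₀ y₀) :
    RegularAt κ lam (fun y => f x₀ y) y₀ :=
  hf.swap.left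

theorem regularAt_id (x₀ : X) : RegularAt ι ι (fun x => x) x₀ :=
  ⟨1, MvPolynomial.X, isHomogeneous_X Qbar, by simpa using (ι x₀).rep_nonzero,
    fun x => ⟨1, by simp⟩⟩

theorem exists_rep_eq_smul {p : ProjSpace n} {v : Fin (n + 1) → Qbar} {hv : v ≠ 0}
    (h : p = Projectivization.mk Qbar v hv) : ∃ c : Qbar, c ≠ 0 ∧ p.rep = c • v := by
  subst h
  obtain ⟨c, hc⟩ := Projectivization.exists_smul_eq_mk_rep Qbar v hv
  exact ⟨c, c.ne_zero, hc.symm⟩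

/-- Regularity may be checked on any choice of coordinate vectors. -/
theorem RegularAt.of_vec {f : X → Y} {x₀ : X} {vι : X → Fin (l + 1) → Qbar}
    {vκ : Y → Fin (m + 1) → Qbar} (hvι : ∀ x, ∃ h, ι x = Projectivization.mk Qbar (vι x) h)
    (hvκ : ∀ y, ∃ h, κ y = Projectivization.mk Qbar (vκ y) h) {a : ℕ}
    {F : Fin (m + 1) → MvPolynomial (Fin (l + 1)) Qbar} (hF : ∀ j, (F j).IsHomogeneous a)
    (hF0 : (fun j => eval (vι x₀) (F j)) ≠ 0)
    (hFx : ∀ x, ∃ c : Qbar, (fun j => eval (vι x) (F j)) = c • vκ (f x)) :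
    RegularAt ι κ f x₀ := by
  have key : ∀ x, ∃ c : Qbar, c ≠ 0 ∧
      (fun j => eval (ι x).rep (F j)) = c • (fun j => eval (vι x) (F j)) := by
    intro x
    obtain ⟨h, e⟩ := hvι x
    obtain ⟨c, hc, e'⟩ := exists_rep_eq_smul e
    refine ⟨c ^ a, pow_ne_zero _ hc, funext fun j => ?_⟩
    rw [e', eval_smul_of_isHomogeneous (hF j)]
    rfl
  refine ⟨a, F, hF, ?_, fun x => ?_⟩
  · obtain ⟨c, hc, e⟩ := key x₀
    rw [e]
    exact smul_ne_zero hc hF0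
  · obtain ⟨c, hc, e⟩ := key x
    obtain ⟨c', e'⟩ := hFx x
    obtain ⟨h, e''⟩ := hvκ (f x)
    obtain ⟨u, hu, eu⟩ := exists_rep_eq_smul e''
    refine ⟨c * c' * u⁻¹, ?_⟩
    rw [e, e', eu, smul_smul, smul_smul, mul_assoc _ u⁻¹, inv_mul_cancel₀ hu, mul_one]

theorem RegularAt₂.of_vec {f : X → Y → Z} {x₀ : X} {y₀ : Y} {vι : X → Fin (l + 1) → Qbar}
    {vκ : Y → Fin (m + 1) → Qbar} {vlam : Z → Fin (n + 1) → Qbar}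
    (hvι : ∀ x, ∃ h, ι x = Projectivization.mk Qbar (vι x) h)
    (hvκ : ∀ y, ∃ h, κ y = Projectivization.mk Qbar (vκ y) h)
    (hvlam : ∀ z, ∃ h, lam z = Projectivization.mk Qbar (vlam z) h) {a b : ℕ}
    {F : Fin (n + 1) → MvPolynomial (Fin (l + 1) ⊕ Fin (m + 1)) Qbar}
    (hF : ∀ j, IsBihomogeneous (F j) a b)
    (hF0 : (fun j => eval (Sum.elim (vι x₀) (vκ y₀)) (F j)) ≠ 0)
    (hFx : ∀ x y, ∃ c : Qbar,
      (fun j => eval (Sum.elim (vι x) (vκ y)) (F j)) = c • vlam (f x y)) :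
    RegularAt₂ ι κ lam f x₀ y₀ := by
  have key : ∀ x y, ∃ c : Qbar, c ≠ 0 ∧
      (fun j => eval (Sum.elim (ι x).rep (κ y).rep) (F j)) =
        c • (fun j => eval (Sum.elim (vι x) (vκ y)) (F j)) := by
    intro x y
    obtain ⟨h, e⟩ := hvι x
    obtain ⟨c, hc, e'⟩ := exists_rep_eq_smul e
    obtain ⟨h₂, e₂⟩ := hvκ y
    obtain ⟨c₂, hc₂, e₂'⟩ := exists_rep_eq_smul e₂
    refine ⟨c ^ a * c₂ ^ b, mul_ne_zero (pow_ne_zero _ hc) (pow_ne_zero _ hc₂),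
      funext fun j => ?_⟩
    rw [e', e₂', (hF j).eval_smul]
    rfl
  refine ⟨a, b, F, hF, ?_, fun x y => ?_⟩
  · obtain ⟨c, hc, e⟩ := key x₀ y₀
    rw [e]
    exact smul_ne_zero hc hF0
  · obtain ⟨c, hc, e⟩ := key x y
    obtain ⟨c', e'⟩ := hFx x y
    obtain ⟨h, e''⟩ := hvlam (f x y)
    obtain ⟨u, hu, eu⟩ := exists_rep_eq_smul e''
    refine ⟨c * c' * u⁻¹, ?_⟩
    rw [e, e', eu, smul_smul, smul_smul, mul_assoc _ u⁻¹, inv_mul_cancel₀ hu, mul_one]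

end Composition

/-! ### The group law of a Weierstrass curve is regular -/

section GroupLaw

open MvPolynomial
open WeierstrassCurve (Projective)

variable (W : WeierstrassCurve ℚ)

/-- Coordinates of a point in the projective plane: `(0, 1, 0)` for the point at infinity and
`(x, y, 1)` for an affine point. -/
def vecE : EPt W → Fin 3 → Qbar
  | .zero => ![0, 1, 0]
  | .some x y _ => ![x, y, 1]

theorem embE_eq (P : EPt W) : ∃ h, embE W P = Projectivization.mk Qbar (vecE W P) h := by
  cases P <;> exact ⟨_, rfl⟩

theorem vecE_ne_zero (P : EPt W) : vecE W P ≠ 0 := (embE_eq W P).1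

theorem eq_of_vecE_eq_smul {P Q : EPt W} {c : Qbar} (h : vecE W P = c • vecE W Q) : P = Q := by
  obtain _ | ⟨x, y, hP⟩ := P <;> obtain _ | ⟨x', y', hQ⟩ := Q
  · rfl
  · have h1 := congrFun h 1
    have h2 := congrFun h 2
    simp [vecE] at h1 h2
    simp [← h2] at h1
  · have h2 := congrFun h 2
    simp [vecE] at h2
  · have h0 := congrFun h 0
    have h1 := congrFun h 1
    have h2 := congrFun h 2
    simp [vecE] at h0 h1 h2
    subst h2
    simp only [one_mul] at h0 h1
    subst h0 h1
    rfl

theorem equation_vecE (P : EPt W) :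
    Projective.Equation (W.baseChange Qbar).toProjective (vecE W P) := by
  obtain _ | ⟨x, y, h⟩ := P
  · exact (Projective.equation_zero)
  · exact (Projective.equation_some x y).mpr h.1

/-- The addition formulas of bidegree `(2, 2)` for distinct points; on the diagonal they vanish. -/
theorem addXYZ_vecE (P Q : EPt W) : ∃ c : Qbar, (P ≠ Q → c ≠ 0) ∧
    (W.baseChange Qbar).toProjective.addXYZ (vecE W P) (vecE W Q) = c • vecE W (P + Q) := by
  have hP := equation_vecE W P
  have hQ := equation_vecE W Q
  by_cases hPQ : P = Q
  · subst hPQ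
    refine ⟨0, fun h => absurd rfl h, ?_⟩
    rw [Projective.addXYZ_self, zero_smul]
    ext i; fin_cases i <;> rfl
  obtain _ | ⟨x, y, h⟩ := P
  · refine ⟨_, fun _ => ?_, (Projective.addXYZ_of_Z_eq_zero_left hP rfl).trans (by
      rw [← WeierstrassCurve.Affine.Point.zero_def, zero_add])⟩
    obtain _ | ⟨x', y', h'⟩ := Q
    · exact absurd rfl hPQ
    · simp [vecE]
  obtain _ | ⟨x', y', h'⟩ := Q
  · refine ⟨_, fun _ => ?_, (Projective.addXYZ_of_Z_eq_zero_right hQ rfl).trans (by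
      rw [← WeierstrassCurve.Affine.Point.zero_def, add_zero])⟩
    simp [vecE]
  have hPz : vecE W (.some x y h) 2 ≠ 0 := by simp [vecE]
  have hQz : vecE W (.some x' y' h') 2 ≠ 0 := by simp [vecE]
  by_cases hx : x = x'
  · have hy : y ≠ y' := by
      rintro rfl
      subst hx
      exact hPQ rfl
    have hy' : y = (W.baseChange Qbar).toAffine.negY x' y' :=
      WeierstrassCurve.Affine.Y_eq_of_X_eq h.1 h'.1 hx |>.resolve_left hy
    rw [WeierstrassCurve.Affine.Point.add_of_Y_eq hx hy']
    refine ⟨_, fun _ => ?_, Projective.addXYZ_of_X_eq hP hQ hPz hQz (by simp [vecE, hx])⟩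
    exact Projective.addU_ne_zero_of_Y_ne hPz hQz (by simpa [vecE] using hy)
  · have hx' : vecE W (.some x y h) 0 * vecE W (.some x' y' h') 2 ≠
        vecE W (.some x' y' h') 0 * vecE W (.some x y h) 2 := by simpa [vecE] using hx
    rw [WeierstrassCurve.Affine.Point.add_of_X_ne hx]
    refine ⟨_, fun _ => Projective.addZ_ne_zero_of_X_ne hP hQ hx',
      (Projective.addXYZ_of_Z_ne_zero hP hQ hPz hQz hx').trans ?_⟩
    simp [vecE]

/-- The addition formulas `addXYZ` as polynomials in the two triples of coordinates. -/
def addPoly (j : Fin 3) : MvPolynomial (Fin 3 ⊕ Fin 3) Qbar :=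
  ((W.baseChange Qbar).map (C : Qbar →+* MvPolynomial (Fin 3 ⊕ Fin 3) Qbar)).toProjective.addXYZ
    (fun i => X (Sum.inl i)) (fun i => X (Sum.inr i)) j

theorem eval_addPoly (v w : Fin 3 → Qbar) (j : Fin 3) :
    eval (Sum.elim v w) (addPoly W j) = (W.baseChange Qbar).toProjective.addXYZ v w j := by
  have h := Projective.map_addXYZ
    (W' := ((W.baseChange Qbar).map (C : Qbar →+* MvPolynomial (Fin 3 ⊕ Fin 3) Qbar)).toProjective)
    (eval (Sum.elim v w)) (fun i => X (Sum.inl i)) (fun i => X (Sum.inr i))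
  have e1 : (eval (Sum.elim v w)) ∘ (fun i => X (Sum.inl i)) = v := by ext; simp
  have e2 : (eval (Sum.elim v w)) ∘ (fun i => X (Sum.inr i)) = w := by ext; simp
  have e3 : (((W.baseChange Qbar).map
      (C : Qbar →+* MvPolynomial (Fin 3 ⊕ Fin 3) Qbar)).toProjective.map
      (eval (Sum.elim v w))) = (W.baseChange Qbar).toProjective := by
    ext <;> simp
  rw [e1, e2, e3] at h
  exact (congrFun h j).symm

theorem IsWeightedHomogeneous.mul_of_eq {σ : Type*} {w : σ → ℕ} {p q : MvPolynomial σ Qbar}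
    {m n k : ℕ} (hp : p.IsWeightedHomogeneous w m) (hq : q.IsWeightedHomogeneous w n)
    (h : m + n = k) : (p * q).IsWeightedHomogeneous w k :=
  h ▸ hp.mul hq

/-- The Mathlib lemma with the instances on the coefficients specialized to those of `Qbar`, so
that it applies at reducible transparency. -/
theorem IsWeightedHomogeneous.sub {σ : Type*} {w : σ → ℕ} {p q : MvPolynomial σ Qbar}
    {k : ℕ} (hp : p.IsWeightedHomogeneous w k) (hq : q.IsWeightedHomogeneous w k) :
    (p - q).IsWeightedHomogeneous w k :=
  MvPolynomial.IsWeightedHomogeneous.sub hp hq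

/-- The Mathlib lemma with the instances on the coefficients specialized to those of `Qbar`, so
that it applies at reducible transparency. -/
theorem IsWeightedHomogeneous.neg {σ : Type*} {w : σ → ℕ} {p : MvPolynomial σ Qbar}
    {k : ℕ} (hp : p.IsWeightedHomogeneous w k) : (-p).IsWeightedHomogeneous w k :=
  MvPolynomial.IsWeightedHomogeneous.neg hp

/-- Stated for a general weight that is constant on each of the two sets of variables, so as to
cover both partial degrees at once. -/
theorem isWeightedHomogeneous_addPoly {w : Fin 3 ⊕ Fin 3 → ℕ}
    (hl : ∀ i, w (Sum.inl i) = w (Sum.inl 0)) (hr : ∀ i, w (Sum.inr i) = w (Sum.inr 0))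
    (j : Fin 3) :
    (addPoly W j).IsWeightedHomogeneous w (2 * w (Sum.inl 0) + 2 * w (Sum.inr 0)) := by
  have h3 : (3 : MvPolynomial (Fin 3 ⊕ Fin 3) Qbar) = C 3 := (map_ofNat C 3).symm
  have h2 : (2 : MvPolynomial (Fin 3 ⊕ Fin 3) Qbar) = C 2 := (map_ofNat C 2).symm
  have hX : ∀ i, (X (Sum.inl i) : MvPolynomial _ Qbar).IsWeightedHomogeneous w (w (Sum.inl 0)) :=
    fun i => hl i ▸ isWeightedHomogeneous_X Qbar w _
  have hY : ∀ i, (X (Sum.inr i) : MvPolynomial _ Qbar).IsWeightedHomogeneous w (w (Sum.inr 0)) :=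
    fun i => hr i ▸ isWeightedHomogeneous_X Qbar w _
  fin_cases j <;>
    simp only [addPoly, Projective.addXYZ, Matrix.cons_val, Projective.addX, Projective.addY,
      Projective.negAddY, Projective.addZ, Projective.negY_eq, pow_two, h3, h2, Fin.zero_eta,
      Fin.mk_one, Fin.reduceFinMk, WeierstrassCurve.map_a₁, WeierstrassCurve.map_a₂,
      WeierstrassCurve.map_a₃, WeierstrassCurve.map_a₄, WeierstrassCurve.map_a₆] <;>
    repeat' with_reducible first
      | apply IsWeightedHomogeneous.sub
      | apply MvPolynomial.IsWeightedHomogeneous.add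
      | apply IsWeightedHomogeneous.mul_of_eq
      | apply IsWeightedHomogeneous.neg
      | exact hX _
      | exact hY _
      | exact isWeightedHomogeneous_C _ _
      | exact rfl
  all_goals ring

theorem isBihomogeneous_addPoly (j : Fin 3) : IsBihomogeneous (addPoly W j) 2 2 :=
  ⟨isWeightedHomogeneous_addPoly W (fun _ => rfl) (fun _ => rfl) j,
    isWeightedHomogeneous_addPoly W (fun _ => rfl) (fun _ => rfl) j⟩

theorem regularAt₂_add_of_ne {P Q : EPt W} (h : P ≠ Q) :
    RegularAt₂ (embE W) (embE W) (embE W) (fun P Q => P + Q) P Q := by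
  refine RegularAt₂.of_vec (embE_eq W) (embE_eq W) (embE_eq W) (isBihomogeneous_addPoly W) ?_ ?_
  · obtain ⟨c, hc, e⟩ := addXYZ_vecE W P Q
    rw [funext (eval_addPoly W (vecE W P) (vecE W Q)), e]
    exact smul_ne_zero (hc h) (vecE_ne_zero W _)
  · intro P Q
    obtain ⟨c, -, e⟩ := addXYZ_vecE W P Q
    exact ⟨c, (funext (eval_addPoly W (vecE W P) (vecE W Q))).trans e⟩

theorem regularAt_add_right_of_ne {P Q : EPt W} (h : P ≠ Q) :
    RegularAt (embE W) (embE W) (fun P => P + Q) P :=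
  (regularAt₂_add_of_ne W h).left

/-- A translation is the composite of two translations by points at which the addition formulas
for distinct points apply; the two auxiliary points leave enough room for this. -/
theorem regularAt_add_right {R₁ R₂ : EPt W} (h₁ : R₁ ≠ 0) (h₂ : R₂ ≠ 0) (h : R₁ + R₁ ≠ R₂ + R₂)
    (P Q : EPt W) : RegularAt (embE W) (embE W) (fun P => P + Q) P := by
  by_cases hPQ : P = Q
  · subst hPQ
    obtain ⟨R, hR, hR'⟩ : ∃ R, R ≠ 0 ∧ P + P ≠ R + R := by
      by_cases h' : P + P = R₁ + R₁
      · exact ⟨R₂, h₂, h' ▸ h⟩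
      · exact ⟨R₁, h₁, h'⟩
    have e : (fun S : EPt W => S + P) = fun S => (S + (P - R)) + R := by
      ext S; abel
    rw [e]
    refine RegularAt.comp (κ := embE W) (g := fun S => S + R) (regularAt_add_right_of_ne W ?_)
      (regularAt_add_right_of_ne W ?_)
    · intro h'
      apply hR'
      calc P + P = P + (P - R) + R := by abel
        _ = R + R := by rw [h']
    · intro h'
      exact hR (by simpa using h'.symm)
  · exact regularAt_add_right_of_ne W hPQ

/-- On the diagonal, addition is rewritten as `(S, T) ↦ ((S + R₁) + T) - R₁`, where the two points
added are distinct. -/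
theorem regularAt₂_add {R₁ R₂ : EPt W} (h₁ : R₁ ≠ 0) (h₂ : R₂ ≠ 0) (h : R₁ + R₁ ≠ R₂ + R₂)
    (P Q : EPt W) : RegularAt₂ (embE W) (embE W) (embE W) (fun P Q => P + Q) P Q := by
  by_cases hPQ : P = Q
  · subst hPQ
    have e : (fun S T : EPt W => S + T) = fun S T => ((S + R₁) + T) + -R₁ := by
      ext S T; abel
    rw [e]
    refine RegularAt.comp₂ (lam := embE W) (g := fun S => S + -R₁)
      (regularAt_add_right W h₁ h₂ h _ _) (RegularAt₂.comp (f := fun S T => S + T)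
        (h := fun T => T) (g := fun S => S + R₁) (ι := embE W) (κ := embE W)
        (regularAt₂_add_of_ne W ?_) (regularAt_add_right W h₁ h₂ h _ _) (regularAt_id _))
    intro h'
    exact h₁ (by simpa using h')
  · exact regularAt₂_add_of_ne W hPQ

theorem vecE_neg (P : EPt W) :
    ∃ c : Qbar, (W.baseChange Qbar).toProjective.neg (vecE W P) = c • vecE W (-P) := by
  obtain _ | ⟨x, y, h⟩ := P
  · refine ⟨-1, ?_⟩
    rw [← WeierstrassCurve.Affine.Point.zero_def, neg_zero]
    ext i
    fin_cases i <;> simp [vecE, Projective.neg, Projective.negY]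
  · refine ⟨1, ?_⟩
    rw [WeierstrassCurve.Affine.Point.neg_some, one_smul]
    ext i
    fin_cases i <;> simp [vecE, Projective.neg, Projective.negY, WeierstrassCurve.Affine.negY]

theorem regularAt_neg (P : EPt W) : RegularAt (embE W) (embE W) (fun P => -P) P := by
  have key : ∀ v : Fin 3 → Qbar, (fun j => eval v
      ((![X 0, -X 1 - C (W.baseChange Qbar).a₁ * X 0 - C (W.baseChange Qbar).a₃ * X 2, X 2] :
        Fin 3 → MvPolynomial (Fin 3) Qbar) j)) = (W.baseChange Qbar).toProjective.neg v := by
    intro v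
    ext j
    fin_cases j <;> simp [Projective.neg, Projective.negY]
  refine RegularAt.of_vec (a := 1) (embE_eq W) (embE_eq W)
    (F := ![X 0, -X 1 - C (W.baseChange Qbar).a₁ * X 0 - C (W.baseChange Qbar).a₃ * X 2, X 2])
    ?_ ?_ ?_
  · intro j
    fin_cases j
    · exact isHomogeneous_X _ _
    · exact ((isHomogeneous_X _ _).neg.sub ((isHomogeneous_X _ _).C_mul _)).sub
        ((isHomogeneous_X _ _).C_mul _)
    · exact isHomogeneous_X _ _
  · rw [key]
    intro h
    obtain _ | ⟨x, y, h'⟩ := P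
    · simpa [vecE, Projective.neg, Projective.negY] using congrFun h 1
    · simpa [vecE, Projective.neg, Projective.negY] using congrFun h 2
  · intro Q
    rw [key]
    exact vecE_neg W Q

end GroupLaw

theorem regularAt₂_sub (t : ℚˣ) (P Q : EPt (E' t)) :
    RegularAt₂ (embE (E' t)) (embE (E' t)) (embE (E' t)) (fun P Q => P - Q) P Q := by
  have hD : D' t ≠ 0 := WeierstrassCurve.Affine.Point.some_ne_zero _
  have hT : T' t ≠ 0 := WeierstrassCurve.Affine.Point.some_ne_zero _
  have h : T' t + T' t ≠ D' t + D' t := by rwa [T'_add_T', D'_add_D']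
  simp only [sub_eq_add_neg]
  exact RegularAt₂.comp (f := fun S T => S + T) (h := fun T => -T) (g := fun S => S)
    (ι := embE (E' t)) (κ := embE (E' t)) (regularAt₂_add _ hT hD h _ _) (regularAt_id _)
    (regularAt_neg _ _)

/-! ### An explicit isomorphism between `E'` and `C'_1` -/

section Model

open MvPolynomial

variable (t : ℚˣ)

theorem db_one : db 1 = 1 := by simp [db]

theorem C'_one_contains_mk {v : Fin 4 → Qbar} (hv : v ≠ 0) :
    (C' t 1).Contains (Projectivization.mk Qbar v hv) ↔
      v 2 * v 0 = v 1 ^ 2 - v 3 ^ 2 ∧ v 2 ^ 2 = v 1 * v 3 + ab t * v 0 ^ 2 := by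
  rw [C'_contains_mk, db_one]
  simp only [one_mul]

theorem four_mul_tb_sq_mul_ab : 4 * tb t ^ 2 * ab t = -1 := by
  have := tb_ne_zero t
  rw [ab_eq]
  field_simp

/-- Completing the square in the equation of `E'`. -/
theorem E'_equation_iff_sq (X Y : Qbar) : Y ^ 2 + X * Y + Ab t * Y = X ^ 3 + Ab t * X ^ 2 ↔
    (2 * Y + X + Ab t) ^ 2 = (X + Ab t) * (4 * X ^ 2 + X + Ab t) := by
  constructor
  · intro h
    linear_combination 4 * h
  · intro h
    linear_combination h / 4

/-- The homogeneous coordinates `[1 : p + q : 4 p q : p - q]`, with denominators cleared, where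
`p = (2 Y + X + A) / (2 t (X + A))` and `q = X / (4 (X + 2 A))`. -/
def coordC (X Y : Qbar) : Fin 4 → Qbar :=
  ![4 * tb t * (X + Ab t) * (X + 2 * Ab t),
    2 * (2 * Y + X + Ab t) * (X + 2 * Ab t) + tb t * X * (X + Ab t),
    2 * (2 * Y + X + Ab t) * X,
    2 * (2 * Y + X + Ab t) * (X + 2 * Ab t) - tb t * X * (X + Ab t)]

/-- Coordinates on `C'_1` of the image of a point of `E'`. The coordinates `coordC` vanish
simultaneously at `(-A, 0)`, whose image is `[0 : 1 : -1 : 1]`. -/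
def vecC : EPt (E' t) → Fin 4 → Qbar
  | .zero => ![0, 1, 1, 1]
  | .some X Y _ => if X + Ab t = 0 then ![0, 1, -1, 1] else coordC t X Y

theorem vecE_zero : vecE (E' t) 0 = ![0, 1, 0] := rfl

theorem vecE_D' : vecE (E' t) (D' t) = ![-Ab t, 0, 1] := rfl

theorem vecC_zero : vecC t 0 = ![0, 1, 1, 1] := rfl

theorem vecC_some_of_ne {X Y : Qbar} (h) (hX : X + Ab t ≠ 0) :
    vecC t (.some X Y h) = coordC t X Y := if_neg hX

theorem vecC_D' : vecC t (D' t) = ![0, 1, -1, 1] := if_pos (by ring)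

/-- The only point of `E'` with `X = -A` is `(-A, 0)`. -/
theorem eq_D' {X Y : Qbar} (h) (hX : X + Ab t = 0) :
    (WeierstrassCurve.Affine.Point.some X Y h : EPt (E' t)) = D' t := by
  have hX' : X = -Ab t := by linear_combination hX
  subst hX'
  have hY : Y ^ 2 = 0 := by linear_combination E'_equation_of_nonsingular t h
  have hY' : Y = 0 := by simpa using hY
  subst hY'
  rfl

/-- Points of `E'` are the point at infinity, the point `(-A, 0)`, or have `X ≠ -A`. -/
theorem point_cases {motive : EPt (E' t) → Prop} (h0 : motive 0) (hD : motive (D' t))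
    (h : ∀ X Y h, X + Ab t ≠ 0 → motive (.some X Y h)) (P : EPt (E' t)) : motive P := by
  obtain _ | ⟨X, Y, hP⟩ := P
  · exact h0
  · by_cases hX : X + Ab t = 0
    · exact eq_D' t hP hX ▸ hD
    · exact h X Y hP hX

theorem coordC_ne_zero {X : Qbar} (Y : Qbar) (hX : X + Ab t ≠ 0) : coordC t X Y ≠ 0 := by
  intro h
  have h0 := congrFun h 0
  have h1 := congrFun h 1
  simp only [coordC, Matrix.cons_val, Pi.zero_apply] at h0 h1
  have hX2 : X + 2 * Ab t = 0 := by simpa [tb_ne_zero, hX] using h0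
  rw [hX2] at h1
  have hX3 : X = 0 := by simpa [tb_ne_zero, hX] using h1
  rw [hX3] at hX2
  simp [Ab_ne_zero] at hX2

theorem vecC_ne_zero (P : EPt (E' t)) : vecC t P ≠ 0 := by
  induction P using point_cases with
  | h0 => exact fun h => one_ne_zero (congrFun h 1)
  | hD => rw [vecC_D']; exact fun h => one_ne_zero (congrFun h 1)
  | h X Y h hX => rw [vecC_some_of_ne t h hX]; exact coordC_ne_zero t Y hX

theorem vecC_contains (P : EPt (E' t)) :
    (C' t 1).Contains (Projectivization.mk Qbar (vecC t P) (vecC_ne_zero t P)) := by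
  rw [C'_one_contains_mk]
  induction P using point_cases with
  | h0 => simp [vecC_zero]
  | hD => simp [vecC_D']
  | h X Y h hX =>
    rw [vecC_some_of_ne t h hX]
    simp only [coordC, Matrix.cons_val]
    refine ⟨by ring, ?_⟩
    have hS := (E'_equation_iff_sq t X Y).mp (E'_equation_of_nonsingular t h)
    linear_combination (4 * X ^ 2 - 4 * (X + 2 * Ab t) ^ 2) * hS +
      X ^ 2 * (X + Ab t) ^ 2 * tb_sq t -
      4 * (X + Ab t) ^ 2 * (X + 2 * Ab t) ^ 2 * four_mul_tb_sq_mul_ab t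

/-- The map `E' → C'_1`, given by the coordinates `vecC`. -/
def psi (P : EPt (E' t)) : (C' t 1).Pt :=
  ⟨Projectivization.mk Qbar (vecC t P) (vecC_ne_zero t P), vecC_contains t P⟩

theorem psi_eq_of_smul {P : EPt (E' t)} {v : Fin 4 → Qbar} {hv : v ≠ 0}
    (h : (C' t 1).Contains (Projectivization.mk Qbar v hv)) {c : Qbar} (hc : vecC t P = c • v) :
    psi t P = ⟨Projectivization.mk Qbar v hv, h⟩ :=
  Subtype.ext ((Projectivization.mk_eq_mk_iff' Qbar _ _ _ _).mpr ⟨c, hc.symm⟩)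

/-- Linear forms computing the inverse of `psi` away from the image of `(-A, 0)`, in which
`w - s`, `w + s` and `u` stand for `2 q z`, `2 p z` and `4 p q z`. -/
def invPoly : Fin 3 → MvPolynomial (Fin 4) Qbar :=
  ![C (8 * Ab t) * (X 1 - X 3),
    C (tb t * Ab t) * (X 1 + X 3 + C 2 * X 2) - C (Ab t) * (X 0 + C 2 * (X 1 - X 3)),
    C 2 * (X 0 - C 2 * (X 1 - X 3))]

/-- Cubic forms computing the inverse of `psi` near the image `[0 : 1 : -1 : 1]` of `(-A, 0)`,
where the linear forms `invPoly` vanish simultaneously. -/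
def invPoly' : Fin 3 → MvPolynomial (Fin 4) Qbar :=
  ![C (8 * Ab t * tb t) * X 2 * (X 1 + X 3) * (X 1 + X 3 - C 2 * X 2),
    (C (64 * Ab t ^ 2) * X 2 * X 2 + C (4 * Ab t) * X 2 * (X 1 + X 3 - C 2 * X 2) +
        C (Ab t) * (X 1 + X 3 - C 2 * X 2) * (X 1 + X 3 - C 2 * X 2)) * X 0 -
      C (4 * Ab t * tb t) * X 2 * (X 1 + X 3) * (X 1 + X 3 - C 2 * X 2) -
      C (Ab t * tb t) * (X 1 + X 3) * (X 1 + X 3 - C 2 * X 2) * (X 1 + X 3 - C 2 * X 2),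
    C (2 * tb t) * (X 1 + X 3) * (X 1 + X 3 - C 2 * X 2) * (X 1 + X 3 - C 2 * X 2)]

theorem eval_invPoly_vecC (P : EPt (E' t)) : ∃ c : Qbar, (P ≠ D' t → c ≠ 0) ∧
    (fun j => eval (vecC t P) (invPoly t j)) = c • vecE (E' t) P := by
  have ht := tb_ne_zero t
  have hA := Ab_ne_zero t
  induction P using point_cases with
  | h0 =>
    refine ⟨4 * tb t * Ab t, fun _ => by simp [ht, hA], ?_⟩
    rw [vecC_zero, vecE_zero]
    ext j
    fin_cases j <;> simp [invPoly]
    ring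
  | hD =>
    refine ⟨0, fun h => absurd rfl h, ?_⟩
    rw [vecC_D']
    ext j
    fin_cases j <;> simp [invPoly]
    exact Or.inr (by norm_num)
  | h X Y h hX =>
    refine ⟨16 * tb t * Ab t * (X + Ab t), fun _ => by simp [ht, hA, hX], ?_⟩
    rw [vecC_some_of_ne t h hX]
    ext j
    fin_cases j <;> simp [coordC, invPoly, vecE] <;> ring

theorem eval_invPoly'_vecC (P : EPt (E' t)) : ∃ c : Qbar, (P = D' t → c ≠ 0) ∧
    (fun j => eval (vecC t P) (invPoly' t j)) = c • vecE (E' t) P := by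
  have ht := tb_ne_zero t
  have hA := Ab_ne_zero t
  induction P using point_cases with
  | h0 =>
    refine ⟨0, fun h => absurd h.symm (WeierstrassCurve.Affine.Point.some_ne_zero _), ?_⟩
    rw [vecC_zero]
    ext j
    fin_cases j <;> simp [invPoly'] <;>
      first | ring1 | exact Or.inr (by ring1)
  | hD =>
    refine ⟨64 * tb t, fun _ => by simp [ht], ?_⟩
    rw [vecC_D', vecE_D']
    ext j
    fin_cases j <;> simp [invPoly'] <;> ring
  | h X Y h hX =>
    refine ⟨512 * tb t * Ab t ^ 2 * (2 * Y + X + Ab t) ^ 3 * (X + 2 * Ab t), fun h' => ?_, ?_⟩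
    · rw [D', WeierstrassCurve.Affine.Point.some.injEq] at h'
      rw [h'.1] at hX
      simp at hX
    · have hS := (E'_equation_iff_sq t X Y).mp (E'_equation_of_nonsingular t h)
      rw [vecC_some_of_ne t h hX]
      ext j
      fin_cases j
      · simp [coordC, invPoly', vecE]
        ring
      · simp [coordC, invPoly', vecE]
        linear_combination (-256 * Ab t ^ 2 * tb t * (2 * Y + X + Ab t) ^ 2 * (X + 2 * Ab t)) * hS
      · simp [coordC, invPoly', vecE]
        ring

/-- The linear forms `invPoly` recover a point of `E'` other than `(-A, 0)`; if both points are
`(-A, 0)` there is nothing to prove. -/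
theorem psi_injective : Function.Injective (psi t) := by
  intro P Q h
  obtain ⟨c, hc⟩ := (Projectivization.mk_eq_mk_iff' Qbar _ _ _ _).mp (congrArg Subtype.val h)
  have key : ∀ {P Q : EPt (E' t)} {c : Qbar}, c • vecC t Q = vecC t P → P ≠ D' t → P = Q := by
    intro P Q c hc hP
    obtain ⟨u, hu, eu⟩ := eval_invPoly_vecC t P
    obtain ⟨v, -, ev⟩ := eval_invPoly_vecC t Q
    have e : (fun j => eval (vecC t P) (invPoly t j)) =
        c • (fun j => eval (vecC t Q) (invPoly t j)) := by
      rw [← hc]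
      ext j
      fin_cases j <;> simp [invPoly] <;> ring
    rw [eu, ev] at e
    apply eq_of_vecE_eq_smul (E' t) (c := u⁻¹ * (c * v))
    rw [mul_smul, mul_smul, ← e, smul_smul, inv_mul_cancel₀ (hu hP), one_smul]
  by_cases hP : P = D' t
  · by_cases hQ : Q = D' t
    · rw [hP, hQ]
    · obtain ⟨c', hc'⟩ := (Projectivization.mk_eq_mk_iff' Qbar _ _ _ _).mp
        (congrArg Subtype.val h.symm)
      exact (key hc' hQ).symm
  · exact key hc hP

theorem vecC_T' : vecC t (T' t) = (2 * tb t * Ab t ^ 2) • ![0, 1, -im, -1] := by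
  have hX : -2 * Ab t + Ab t ≠ 0 := by
    intro h
    exact Ab_ne_zero t (by linear_combination -h)
  rw [T', vecC_some_of_ne t _ hX]
  ext j
  fin_cases j <;> simp [coordC] <;> ring

theorem vecC_neg_T' : vecC t (-T' t) = (2 * tb t * Ab t ^ 2) • ![0, 1, im, -1] := by
  have hX : -2 * Ab t + Ab t ≠ 0 := by
    intro h
    exact Ab_ne_zero t (by linear_combination -h)
  obtain ⟨h, e⟩ := neg_T' t
  rw [e, vecC_some_of_ne t _ hX]
  ext j
  fin_cases j <;> simp [coordC] <;> ring

/-- The equation of `C'_1` in the coordinates `p = (w + s) / (2 z)`, `q = (w - s) / (2 z)` never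
admits `q = ±1/4`, as `t² + 4 ≠ 0`. -/
theorem one_sub_sq_ne_zero {p q : Qbar} (h : p ^ 2 - q ^ 2 = 16 * p ^ 2 * q ^ 2 - ab t) :
    1 - 16 * q ^ 2 ≠ 0 := by
  intro h'
  apply Ab_ne_zero t
  linear_combination Ab_eq t + (1 / 16) * four_mul_tb_sq_mul_ab t -
    (tb t ^ 2 / 4) * (h - p ^ 2 * h') + (tb t ^ 2 / 64) * h'

/-- At a point with `z ≠ 0`, the values of `p = (w + s) / (2 z)` and `q = (w - s) / (2 z)` determine
`X` from `q = X / (4 (X + 2 A))` and then `Y` from `p = (2 Y + X + A) / (2 t (X + A))`. The four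
points with `z = 0` are the images of the multiples of `T'`. -/
theorem psi_surjective : Function.Surjective (psi t) := by
  have ht := tb_ne_zero t
  have hA := Ab_ne_zero t
  rintro ⟨x, hx⟩
  induction x using Projectivization.ind with | h v hv =>
  obtain ⟨h1, h2⟩ := (C'_one_contains_mk t hv).mp hx
  by_cases hz : v 0 = 0
  · have hws : (v 1 - v 3) * (v 1 + v 3) = 0 := by rw [hz] at h1; linear_combination -h1
    rw [hz] at h2
    rcases mul_eq_zero.mp hws with hs | hs
    · have hs' : v 3 = v 1 := by linear_combination -hs
      have hu : (v 2 - v 1) * (v 2 + v 1) = 0 := by rw [hs'] at h2; linear_combination h2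
      have h10 : v 1 ≠ 0 := by
        intro h10
        refine hv (_root_.funext fun i => ?_)
        rw [h10] at hs' hu
        have hu' : v 2 = 0 := by simpa using hu
        fin_cases i <;> assumption
      rcases mul_eq_zero.mp hu with hu | hu
      · have hu' : v 2 = v 1 := by linear_combination hu
        refine ⟨0, psi_eq_of_smul t hx (c := (v 1)⁻¹) ?_⟩
        ext i
        fin_cases i <;> simp [vecC_zero, hz, hs', hu', h10]
      · have hu' : v 2 = -v 1 := by linear_combination hu
        refine ⟨D' t, psi_eq_of_smul t hx (c := (v 1)⁻¹) ?_⟩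
        ext i
        fin_cases i <;> simp [vecC_D', hz, hs', hu', h10]
    · have hs' : v 3 = -v 1 := by linear_combination hs
      have hu : (v 2 - im * v 1) * (v 2 + im * v 1) = 0 := by
        rw [hs'] at h2
        linear_combination h2 - v 1 ^ 2 * im_sq
      have h10 : v 1 ≠ 0 := by
        intro h10
        refine hv (_root_.funext fun i => ?_)
        rw [h10] at hs' hu
        have hu' : v 2 = 0 := by simpa using hu
        fin_cases i
        · exact hz
        · exact h10
        · exact hu'
        · simpa using hs'
      rcases mul_eq_zero.mp hu with hu | hu
      · have hu' : v 2 = im * v 1 := by linear_combination hu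
        refine ⟨-T' t, psi_eq_of_smul t hx (c := (2 * tb t * Ab t ^ 2) * (v 1)⁻¹) ?_⟩
        rw [vecC_neg_T', mul_smul (2 * tb t * Ab t ^ 2) (v 1)⁻¹ v]
        refine congrArg _ (_root_.funext fun i => ?_)
        fin_cases i <;> simp [hz, hs', hu', h10]
        field_simp
      · have hu' : v 2 = -im * v 1 := by linear_combination hu
        refine ⟨T' t, psi_eq_of_smul t hx (c := (2 * tb t * Ab t ^ 2) * (v 1)⁻¹) ?_⟩
        rw [vecC_T', mul_smul (2 * tb t * Ab t ^ 2) (v 1)⁻¹ v]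
        refine congrArg _ (_root_.funext fun i => ?_)
        fin_cases i <;> simp [hz, hs', hu', h10]
        field_simp
  -- `p`, `q`, `X`, `Y` are kept opaque, known only through the equations they satisfy
  · obtain ⟨p, hp⟩ : ∃ p, p = (v 1 + v 3) / (2 * v 0) := ⟨_, rfl⟩
    obtain ⟨q, hq⟩ : ∃ q, q = (v 1 - v 3) / (2 * v 0) := ⟨_, rfl⟩
    have hw : v 1 = v 0 * (p + q) := by rw [hp, hq]; field_simp; ring
    have hs : v 3 = v 0 * (p - q) := by rw [hp, hq]; field_simp; ring
    have hu : v 2 = v 0 * (4 * p * q) := by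
      apply mul_right_cancel₀ hz
      rw [h1, hw, hs]
      ring
    have key : p ^ 2 - q ^ 2 = 16 * p ^ 2 * q ^ 2 - ab t := by
      apply mul_left_cancel₀ (pow_ne_zero 2 hz)
      rw [hu, hw, hs] at h2
      linear_combination -h2
    have hq0 := one_sub_sq_ne_zero t key
    have hq1 : 1 - 4 * q ≠ 0 := fun h => hq0 (by linear_combination (1 + 4 * q) * h)
    have hq2 : 1 + 4 * q ≠ 0 := fun h => hq0 (by linear_combination (1 - 4 * q) * h)
    obtain ⟨X, hX⟩ : ∃ X, X = 8 * Ab t * q / (1 - 4 * q) := ⟨_, rfl⟩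
    have hXA : X + Ab t = Ab t * (1 + 4 * q) / (1 - 4 * q) := by
      rw [hX, eq_div_iff hq1, add_mul, div_mul_cancel₀ _ hq1]; ring
    have hXA2 : X + 2 * Ab t = 2 * Ab t / (1 - 4 * q) := by
      rw [hX, eq_div_iff hq1, add_mul, div_mul_cancel₀ _ hq1]; ring
    have hX0 : X + Ab t ≠ 0 := by
      rw [hXA]
      exact div_ne_zero (mul_ne_zero hA hq2) hq1
    have hqX : 4 * q * (X + 2 * Ab t) = X := by
      rw [hXA2, hX]; ring
    have hpX : 4 * tb t ^ 2 * p ^ 2 * (X + Ab t) = 4 * X ^ 2 + X + Ab t := by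
      have e : 4 * X ^ 2 + X + Ab t =
          Ab t * (256 * Ab t * q ^ 2 + 1 - 16 * q ^ 2) / (1 - 4 * q) ^ 2 := by
        rw [hX]; field_simp; ring
      rw [e, hXA, eq_div_iff (pow_ne_zero 2 hq1)]
      field_simp
      linear_combination 4 * tb t ^ 2 * key + 4 * q ^ 2 * tb_sq t - four_mul_tb_sq_mul_ab t
    obtain ⟨Y, hY⟩ : ∃ Y, Y = (2 * tb t * p * (X + Ab t) - X - Ab t) / 2 := ⟨_, rfl⟩
    have hS : 2 * Y + X + Ab t = 2 * tb t * p * (X + Ab t) := by rw [hY]; ring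
    have hE := E'_nonsingular_of_equation t ((E'_equation_iff_sq t X Y).mpr (by
      rw [hS]
      linear_combination (X + Ab t) * hpX))
    refine ⟨.some X Y hE, psi_eq_of_smul t hx
      (c := 4 * tb t * (X + Ab t) * (X + 2 * Ab t) * (v 0)⁻¹) ?_⟩
    rw [vecC_some_of_ne t hE hX0, mul_smul]
    have e : (v 0)⁻¹ • v = ![1, p + q, 4 * p * q, p - q] := by
      ext i
      fin_cases i <;> simp [hz, hw, hs, hu]
    rw [e]
    ext i
    fin_cases i <;> simp [coordC, hS]
    · linear_combination -tb t * (X + Ab t) * hqX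
    · linear_combination -4 * tb t * p * (X + Ab t) * hqX
    · linear_combination tb t * (X + Ab t) * hqX

/-- The isomorphism `E' ≃ C'_1`. -/
def psiEquiv : EPt (E' t) ≃ (C' t 1).Pt :=
  Equiv.ofBijective (psi t) ⟨psi_injective t, psi_surjective t⟩

/-- Quadratic forms computing `psi` away from the point at infinity and `(-A, 0)`. -/
def psiPoly : Fin 4 → MvPolynomial (Fin 3) Qbar :=
  ![C (4 * tb t) * (X 0 + C (Ab t) * X 2) * (X 0 + C (2 * Ab t) * X 2),
    C 2 * (C 2 * X 1 + X 0 + C (Ab t) * X 2) * (X 0 + C (2 * Ab t) * X 2) +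
      C (tb t) * X 0 * (X 0 + C (Ab t) * X 2),
    C 2 * (C 2 * X 1 + X 0 + C (Ab t) * X 2) * X 0,
    C 2 * (C 2 * X 1 + X 0 + C (Ab t) * X 2) * (X 0 + C (2 * Ab t) * X 2) -
      C (tb t) * X 0 * (X 0 + C (Ab t) * X 2)]

/-- Quadratic forms computing `psi` near the point at infinity and `(-A, 0)`, obtained from
`psiPoly` by multiplying with `(2 Y + X + A) / (X + A)` and reducing by the equation of `E'`. -/
def psiPoly' : Fin 4 → MvPolynomial (Fin 3) Qbar :=
  ![C (4 * tb t) * (C 2 * X 1 + X 0 + C (Ab t) * X 2) * (X 0 + C (2 * Ab t) * X 2),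
    C 8 * (X 1 * X 1 + X 0 * X 1 + C (Ab t) * X 1 * X 2 + C (Ab t) * X 0 * X 0) +
      C 2 * (X 0 + C (Ab t) * X 2) * (X 0 + C (2 * Ab t) * X 2) +
      C (tb t) * X 0 * (C 2 * X 1 + X 0 + C (Ab t) * X 2),
    C 8 * (X 1 * X 1 + X 0 * X 1 + C (Ab t) * X 1 * X 2 - C (Ab t) * X 0 * X 0) +
      C 2 * X 0 * (X 0 + C (Ab t) * X 2),
    C 8 * (X 1 * X 1 + X 0 * X 1 + C (Ab t) * X 1 * X 2 + C (Ab t) * X 0 * X 0) +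
      C 2 * (X 0 + C (Ab t) * X 2) * (X 0 + C (2 * Ab t) * X 2) -
      C (tb t) * X 0 * (C 2 * X 1 + X 0 + C (Ab t) * X 2)]

theorem eval_psiPoly_vecE (P : EPt (E' t)) : ∃ c : Qbar, (P ≠ 0 → P ≠ D' t → c ≠ 0) ∧
    (fun j => eval (vecE (E' t) P) (psiPoly t j)) = c • vecC t P := by
  induction P using point_cases with
  | h0 =>
    refine ⟨0, fun h => absurd rfl h, ?_⟩
    ext j
    fin_cases j <;> simp [psiPoly, vecE, WeierstrassCurve.Affine.Point.zero_def]
  | hD =>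
    refine ⟨0, fun _ h => absurd rfl h, ?_⟩
    ext j
    fin_cases j <;> simp [psiPoly, vecE, D']
  | h X Y h hX =>
    refine ⟨1, fun _ _ => one_ne_zero, ?_⟩
    rw [vecC_some_of_ne t h hX]
    ext j
    fin_cases j <;> simp [coordC, psiPoly, vecE]

theorem eval_psiPoly'_vecE (P : EPt (E' t)) : ∃ c : Qbar, (P = 0 ∨ P = D' t → c ≠ 0) ∧
    (fun j => eval (vecE (E' t) P) (psiPoly' t j)) = c • vecC t P := by
  have hA := Ab_ne_zero t
  induction P using point_cases with
  | h0 =>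
    refine ⟨8, fun _ => by norm_num, ?_⟩
    rw [vecC_zero, vecE_zero]
    ext j
    fin_cases j <;> simp [psiPoly']
  | hD =>
    refine ⟨8 * Ab t ^ 3, fun _ => by simp [hA], ?_⟩
    rw [vecC_D', vecE_D']
    ext j
    fin_cases j <;> simp [psiPoly'] <;> ring
  | h X Y h hX =>
    refine ⟨(2 * Y + X + Ab t) / (X + Ab t), fun h' => ?_, ?_⟩
    · rcases h' with h' | h'
      · exact absurd h' (WeierstrassCurve.Affine.Point.some_ne_zero _)
      · rw [D', WeierstrassCurve.Affine.Point.some.injEq] at h'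
        rw [h'.1] at hX
        simp at hX
    · have hE := E'_equation_of_nonsingular t h
      rw [vecC_some_of_ne t h hX]
      ext j
      fin_cases j <;> simp [coordC, psiPoly', vecE] <;> field_simp
      · linear_combination (-8 * Ab t) * hE
      · linear_combination 8 * Ab t * hE
      · linear_combination (-8 * Ab t) * hE

end Model

/-! ### Regularity of the isomorphism between `E'` and `C'_1` -/

section ModelRegular

open MvPolynomial

variable (t : ℚˣ)

theorem isHomogeneous_invPoly (j : Fin 3) : (invPoly t j).IsHomogeneous 1 := by
  have hX : ∀ i : Fin 4, (X i : MvPolynomial (Fin 4) Qbar).IsWeightedHomogeneous 1 1 :=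
    isHomogeneous_X Qbar
  change (invPoly t j).IsWeightedHomogeneous 1 1
  fin_cases j <;>
    simp only [invPoly, Fin.zero_eta, Fin.mk_one, Fin.reduceFinMk, Matrix.cons_val] <;>
    repeat' with_reducible first
      | apply IsWeightedHomogeneous.sub
      | apply MvPolynomial.IsWeightedHomogeneous.add
      | apply IsWeightedHomogeneous.mul_of_eq
      | exact hX _
      | exact isWeightedHomogeneous_C _ _
      | exact rfl

theorem isHomogeneous_invPoly' (j : Fin 3) : (invPoly' t j).IsHomogeneous 3 := by
  have hX : ∀ i : Fin 4, (X i : MvPolynomial (Fin 4) Qbar).IsWeightedHomogeneous 1 1 :=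
    isHomogeneous_X Qbar
  change (invPoly' t j).IsWeightedHomogeneous 1 3
  fin_cases j <;>
    simp only [invPoly', Fin.zero_eta, Fin.mk_one, Fin.reduceFinMk, Matrix.cons_val] <;>
    repeat' with_reducible first
      | apply IsWeightedHomogeneous.sub
      | apply MvPolynomial.IsWeightedHomogeneous.add
      | apply IsWeightedHomogeneous.mul_of_eq
      | exact hX _
      | exact isWeightedHomogeneous_C _ _
      | exact rfl

theorem isHomogeneous_psiPoly (j : Fin 4) : (psiPoly t j).IsHomogeneous 2 := by
  have hX : ∀ i : Fin 3, (X i : MvPolynomial (Fin 3) Qbar).IsWeightedHomogeneous 1 1 :=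
    isHomogeneous_X Qbar
  change (psiPoly t j).IsWeightedHomogeneous 1 2
  fin_cases j <;>
    simp only [psiPoly, Fin.zero_eta, Fin.mk_one, Fin.reduceFinMk, Matrix.cons_val] <;>
    repeat' with_reducible first
      | apply IsWeightedHomogeneous.sub
      | apply MvPolynomial.IsWeightedHomogeneous.add
      | apply IsWeightedHomogeneous.mul_of_eq
      | exact hX _
      | exact isWeightedHomogeneous_C _ _
      | exact rfl
  all_goals rfl

theorem isHomogeneous_psiPoly' (j : Fin 4) : (psiPoly' t j).IsHomogeneous 2 := by
  have hX : ∀ i : Fin 3, (X i : MvPolynomial (Fin 3) Qbar).IsWeightedHomogeneous 1 1 :=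
    isHomogeneous_X Qbar
  change (psiPoly' t j).IsWeightedHomogeneous 1 2
  fin_cases j <;>
    simp only [psiPoly', Fin.zero_eta, Fin.mk_one, Fin.reduceFinMk, Matrix.cons_val] <;>
    repeat' with_reducible first
      | apply IsWeightedHomogeneous.sub
      | apply MvPolynomial.IsWeightedHomogeneous.add
      | apply IsWeightedHomogeneous.mul_of_eq
      | exact hX _
      | exact isWeightedHomogeneous_C _ _
      | exact rfl
  all_goals rfl

theorem emb_eq_vecC (p : (C' t 1).Pt) : ∃ h, (C' t 1).emb p =
    Projectivization.mk Qbar (vecC t ((psiEquiv t).symm p)) h := by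
  refine ⟨vecC_ne_zero t _, ?_⟩
  conv_lhs => rw [← (psiEquiv t).apply_symm_apply p]
  rfl

/-- The forms `invPoly` and `invPoly'` together cover `C'_1`. -/
theorem regularAt_psiEquiv_symm (p : (C' t 1).Pt) :
    RegularAt (C' t 1).emb (embE (E' t)) (psiEquiv t).symm p := by
  by_cases hp : (psiEquiv t).symm p = D' t
  · refine RegularAt.of_vec (emb_eq_vecC t) (embE_eq _) (isHomogeneous_invPoly' t) ?_ ?_
    · obtain ⟨c, hc, e⟩ := eval_invPoly'_vecC t ((psiEquiv t).symm p)
      exact e ▸ smul_ne_zero (hc hp) (vecE_ne_zero _ _)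
    · intro q
      obtain ⟨c, -, e⟩ := eval_invPoly'_vecC t ((psiEquiv t).symm q)
      exact ⟨c, e⟩
  · refine RegularAt.of_vec (emb_eq_vecC t) (embE_eq _) (isHomogeneous_invPoly t) ?_ ?_
    · obtain ⟨c, hc, e⟩ := eval_invPoly_vecC t ((psiEquiv t).symm p)
      exact e ▸ smul_ne_zero (hc hp) (vecE_ne_zero _ _)
    · intro q
      obtain ⟨c, -, e⟩ := eval_invPoly_vecC t ((psiEquiv t).symm q)
      exact ⟨c, e⟩

/-- The forms `psiPoly` and `psiPoly'` together cover `E'`. -/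
theorem regularAt_psiEquiv (P : EPt (E' t)) :
    RegularAt (embE (E' t)) (C' t 1).emb (psiEquiv t) P := by
  have key : ∀ Q, vecC t ((psiEquiv t).symm (psiEquiv t Q)) = vecC t Q := by simp
  by_cases hP : P = 0 ∨ P = D' t
  · refine RegularAt.of_vec (embE_eq _) (emb_eq_vecC t) (isHomogeneous_psiPoly' t) ?_ ?_
    · obtain ⟨c, hc, e⟩ := eval_psiPoly'_vecE t P
      exact e ▸ smul_ne_zero (hc hP) (vecC_ne_zero _ _)
    · intro Q
      obtain ⟨c, -, e⟩ := eval_psiPoly'_vecE t Q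
      exact ⟨c, by rw [key, e]⟩
  · rw [not_or] at hP
    refine RegularAt.of_vec (embE_eq _) (emb_eq_vecC t) (isHomogeneous_psiPoly t) ?_ ?_
    · obtain ⟨c, hc, e⟩ := eval_psiPoly_vecE t P
      exact e ▸ smul_ne_zero (hc hP.1 hP.2) (vecC_ne_zero _ _)
    · intro Q
      obtain ⟨c, -, e⟩ := eval_psiPoly_vecE t Q
      exact ⟨c, by rw [key, e]⟩

end ModelRegular

/-! ### Rescaling the curves `C'_d` -/

section Scale

variable (t : ℚˣ)

theorem mk_congr {n : ℕ} {v w : Fin (n + 1) → Qbar} (h : v = w) (hv : v ≠ 0) (hw : w ≠ 0) :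
    Projectivization.mk Qbar v hv = Projectivization.mk Qbar w hw := by
  subst h
  rfl

/-- The linear map `(z, w, u, s) ↦ (e z, e² w, e³ u, s)`, which in the affine coordinates with
`s = 1` is `(z, w) ↦ (e z, e² w)` together with its effect on `u = (w² - d) / z`. -/
def scaleLin (e : Qbar) : (Fin 4 → Qbar) →ₗ[Qbar] (Fin 4 → Qbar) where
  toFun v := ![e * v 0, e ^ 2 * v 1, e ^ 3 * v 2, v 3]
  map_add' v w := by
    ext i
    fin_cases i <;> simp [mul_add]
  map_smul' c v := by
    ext i
    fin_cases i <;> simp [mul_left_comm]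

theorem scaleLin_injective {e : Qbar} (he : e ≠ 0) : Function.Injective (scaleLin e) := by
  intro v w h
  have h0 := congrFun h 0
  have h1 := congrFun h 1
  have h2 := congrFun h 2
  have h3 := congrFun h 3
  simp [scaleLin, he] at h0 h1 h2 h3
  ext i
  fin_cases i <;> assumption

theorem scaleLin_scaleLin (e e' : Qbar) (v : Fin 4 → Qbar) :
    scaleLin e (scaleLin e' v) = scaleLin (e * e') v := by
  ext i
  fin_cases i <;> simp [scaleLin] <;> ring

theorem scaleLin_one (v : Fin 4 → Qbar) : scaleLin 1 v = v := by
  ext i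
  fin_cases i <;> simp [scaleLin]

variable {d d' d'' : ℚˣ}

/-- The morphism `C'_d → C'_{d'}`, `(z, w) ↦ (e z, e² w)`, for `d' = e⁴ d`. -/
def scale {e : Qbar} (he : e ≠ 0) (h : e ^ 4 * db d = db d') (p : (C' t d).Pt) : (C' t d').Pt :=
  ⟨p.1.map (scaleLin e) (scaleLin_injective he), by
    obtain ⟨p, hp⟩ := p
    induction p using Projectivization.ind with | h v hv =>
    rw [C'_contains_mk] at hp
    rw [Projectivization.map_mk, C'_contains_mk, ← h]
    simp only [scaleLin, LinearMap.coe_mk, AddHom.coe_mk, Matrix.cons_val]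
    exact ⟨by linear_combination e ^ 4 * hp.1, by linear_combination e ^ 6 * hp.2⟩⟩

theorem scale_scale {e e' : Qbar} (he : e ≠ 0) (h : e ^ 4 * db d' = db d'') (he' : e' ≠ 0)
    (h' : e' ^ 4 * db d = db d') (p : (C' t d).Pt) : scale t he h (scale t he' h' p) =
      scale t (mul_ne_zero he he') (by rw [mul_pow, mul_assoc, h', h]) p := by
  obtain ⟨p, hp⟩ := p
  induction p using Projectivization.ind with | h v hv =>
  exact Subtype.ext (mk_congr (scaleLin_scaleLin e e' v) _ _)

theorem scale_one (h : 1 ^ 4 * db d = db d) (p : (C' t d).Pt) :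
    scale t one_ne_zero h p = p := by
  obtain ⟨p, hp⟩ := p
  induction p using Projectivization.ind with | h v hv =>
  exact Subtype.ext (mk_congr (scaleLin_one v) _ _)

theorem scale_congr {e e' : Qbar} (he : e ≠ 0) (h : e ^ 4 * db d = db d') (hee' : e = e')
    (p : (C' t d).Pt) : scale t he h p = scale t (hee' ▸ he : e' ≠ 0) (hee' ▸ h) p := by
  subst hee'
  rfl

/-- `scale` as a bijection. -/
def scaleEquiv {e : Qbar} (he : e ≠ 0) (h : e ^ 4 * db d = db d') : (C' t d).Pt ≃ (C' t d').Pt where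
  toFun := scale t he h
  invFun := scale t (inv_ne_zero he) (by
    rw [← h, ← mul_assoc, ← mul_pow, inv_mul_cancel₀ he, one_pow, one_mul])
  left_inv p := by
    rw [scale_scale, scale_congr t _ _ (inv_mul_cancel₀ he), scale_one]
  right_inv p := by
    rw [scale_scale, scale_congr t _ _ (mul_inv_cancel₀ he), scale_one]

open MvPolynomial in
theorem regularAt_scale {e : Qbar} (he : e ≠ 0) (h : e ^ 4 * db d = db d') (p : (C' t d).Pt) :
    RegularAt (C' t d).emb (C' t d').emb (scale t he h) p := by
  set F : Fin 4 → MvPolynomial (Fin 4) Qbar :=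
    ![C e * X 0, C (e ^ 2) * X 1, C (e ^ 3) * X 2, X 3] with hF
  have key : ∀ v : Fin 4 → Qbar, (fun j => eval v (F j)) = scaleLin e v := by
    intro v
    ext j
    fin_cases j <;> simp [hF, scaleLin]
  refine ⟨1, F, ?_, ?_, fun q => ?_⟩
  · intro j
    fin_cases j
    · exact (isHomogeneous_X _ _).C_mul _
    · exact (isHomogeneous_X _ _).C_mul _
    · exact (isHomogeneous_X _ _).C_mul _
    · exact isHomogeneous_X _ _
  · rw [key]
    exact fun h0 => ((C' t d).emb p).rep_nonzero (scaleLin_injective he (by rw [h0, map_zero]))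
  · rw [key, exists_smul_rep_iff]
    intro h0
    change q.1.map (scaleLin e) (scaleLin_injective he) = _
    conv_lhs => rw [← q.1.mk_rep]
    rfl

/-- Rescaling is compatible with the Galois action on points and on the scaling factor. -/
theorem smul_scale (σ : GQ) {e : Qbar} (he : e ≠ 0) (h : e ^ 4 * db d = db d') (p : (C' t d).Pt) :
    ∃ he' h', σ • scale t he h p = scale (e := σ e) t he' h' (σ • p) := by
  have h' : (σ e) ^ 4 * db d = db d' := by
    have := congrArg σ h
    rwa [map_mul, map_pow, db, db, σ.commutes, σ.commutes] at this
  refine ⟨(map_ne_zero σ).mpr he, h', ?_⟩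
  obtain ⟨p, hp⟩ := p
  induction p using Projectivization.ind with | h v hv =>
  refine Subtype.ext ?_
  refine mk_congr (v := galVec 3 σ (scaleLin e v)) (w := scaleLin (σ e) (galVec 3 σ v)) ?_ _ _
  ext i
  fin_cases i <;> simp [galVec, scaleLin]

end Scale

/-! ### Translation by `T'` and the Galois action -/

section Translation

variable (t : ℚˣ)

theorem psi_smul (σ : GQ) (P : EPt (E' t)) : psi t (σ • P) = σ • psi t P := by
  refine Subtype.ext (mk_congr (w := galVec 3 σ (vecC t P)) ?_ _ _)
  have h2 : σ 2 = 2 := map_ofNat σ 2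
  have h4 : σ 4 = 4 := map_ofNat σ 4
  obtain _ | ⟨X, Y, h⟩ := P
  · ext i
    change ![0, 1, 1, 1] i = σ ((![0, 1, 1, 1] : Fin 4 → Qbar) i)
    fin_cases i <;> simp
  · obtain ⟨h', e⟩ := smul_some σ h
    rw [e]
    have e1 : σ X + Ab t = σ (X + Ab t) := by rw [map_add, gal_Ab]
    ext i
    by_cases hX : X + Ab t = 0
    · rw [hX, map_zero] at e1
      simp only [vecC, hX, e1, if_true]
      change _ = σ ((![0, 1, -1, 1] : Fin 4 → Qbar) i)
      fin_cases i <;> simp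
    · have hX' : σ X + Ab t ≠ 0 := by rwa [e1, Ne, EmbeddingLike.map_eq_zero_iff]
      rw [vecC_some_of_ne t _ hX, vecC_some_of_ne t _ hX']
      change _ = σ (coordC t X Y i)
      fin_cases i <;> simp [coordC, gal_Ab, gal_tb, h2, h4]

theorem psiEquiv_symm_smul (σ : GQ) (p : (C' t 1).Pt) :
    (psiEquiv t).symm (σ • p) = σ • (psiEquiv t).symm p := by
  rw [Equiv.symm_apply_eq]
  change _ = psi t _
  rw [psi_smul]
  change _ = σ • psiEquiv t _
  rw [Equiv.apply_symm_apply]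

/-- In the coordinates `p`, `q` of `coordC`, translation by `T'` is `(p, q) ↦ (-i q, -i p)`. -/
theorem add_T'_coord {X Y : Qbar} (hE : Y ^ 2 + X * Y + Ab t * Y = X ^ 3 + Ab t * X ^ 2)
    (hX : X + 2 * Ab t ≠ 0) {l X₃ Y₃ : Qbar}
    (hl : l * (X + 2 * Ab t) = Y - Ab t * (2 + im * tb t) / 4)
    (hX₃ : X₃ = l ^ 2 + l + Ab t - X) (hY₃ : Y₃ = -(l * (X₃ - X) + Y) - X₃ - Ab t) :
    X₃ * (tb t * (X + Ab t)) = -2 * im * (2 * Y + X + Ab t) * (X₃ + 2 * Ab t) ∧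
      (2 * Y₃ + X₃ + Ab t) * (2 * (X + 2 * Ab t)) = -im * X * (tb t * (X₃ + Ab t)) := by
  obtain ⟨D, hD⟩ : ∃ D, D = X + 2 * Ab t := ⟨_, rfl⟩
  have hX' : X = D - 2 * Ab t := by rw [hD]; ring
  have hY' : Y = Ab t * (2 + im * tb t) / 4 + l * D := by rw [hD]; linear_combination -hl
  rw [← hD] at hX
  -- the equation of the curve along the line through `T'` with slope `l`, divided by `X + 2 A`
  have hR : D * (l ^ 2 + l + 5 * Ab t - D) =
      -(Ab t * im * tb t / 4) * (2 * l + 1 + im * tb t / 2) := by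
    apply mul_left_cancel₀ hX
    rw [hX', hY'] at hE
    linear_combination hE + (Ab t * D / 8 - Ab t ^ 2 / 16) * (tb t ^ 2 * im_sq - tb_sq t)
  rw [hY₃, hX₃, hX', hY']
  constructor
  · linear_combination (tb t + 2 * im * (2 * l + 1)) * hR +
      (-Ab t * im * tb t ^ 2 * (2 * l + 1) / 4 - Ab t * tb t ^ 3 / 8 -
        Ab t * tb t * (2 * l + 1) ^ 2 / 2 + Ab t * tb t * (l ^ 2 + l + 5 * Ab t - D)) * im_sq +
      (Ab t * tb t / 8) * tb_sq t
  · linear_combination (im * tb t - 2 * (2 * l + 1)) * hR -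
      (Ab t * im * tb t ^ 3 / 8) * im_sq + (Ab t * im * tb t / 8) * tb_sq t

/-- The chord through `(X, Y)` and `T'`, with slope `l`. -/
theorem some_add_T' {X Y : Qbar} (h : ((E' t).baseChange Qbar).toAffine.Nonsingular X Y)
    (hX : X + 2 * Ab t ≠ 0) : ∃ l X₃ Y₃ h₃,
      (WeierstrassCurve.Affine.Point.some X Y h : EPt (E' t)) + T' t = .some X₃ Y₃ h₃ ∧
      l * (X + 2 * Ab t) = Y - Ab t * (2 + im * tb t) / 4 ∧
      X₃ = l ^ 2 + l + Ab t - X ∧ Y₃ = -(l * (X₃ - X) + Y) - X₃ - Ab t := by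
  have hne : X ≠ -2 * Ab t := fun h => hX (by rw [h]; ring)
  refine ⟨((E' t).baseChange Qbar).toAffine.slope X (-2 * Ab t) Y (Ab t * (2 + im * tb t) / 4),
    _, _, _, WeierstrassCurve.Affine.Point.add_of_X_ne hne, ?_, ?_, ?_⟩
  · rw [WeierstrassCurve.Affine.slope_of_X_ne hne, show X + 2 * Ab t = X - -2 * Ab t by ring,
      div_mul_cancel₀ _ (sub_ne_zero.mpr hne)]
  · simp only [WeierstrassCurve.Affine.addX, E', WeierstrassCurve.baseChange, WeierstrassCurve.map,
      map_one, Ab_fold]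
    ring
  · rw [WeierstrassCurve.Affine.addY, WeierstrassCurve.Affine.negAddY, WeierstrassCurve.Affine.negY]
    simp only [E', WeierstrassCurve.baseChange, WeierstrassCurve.map, map_one, Ab_fold]
    ring

theorem phiHat_some_eq_zero_iff {X Y : Qbar} (h) :
    phiHat t (.some X Y h) = 0 ↔ ¬ (X + Ab t ≠ 0 ∧ X + 2 * Ab t ≠ 0) := by
  rw [phiHat]
  split_ifs with hX
  · simp [hX]
  · simp only [hX, not_false_eq_true, iff_true]
    rfl

/-- Used to see that the affine formulas remain available after translation by `T'`. -/
theorem phiHat_add_T'_eq_zero_iff (P : EPt (E' t)) :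
    phiHat t (P + T' t) = 0 ↔ phiHat t P = 0 := by
  rw [phiHat_eq_zero_iff, phiHat_eq_zero_iff,
    add_mem_cancel_right (AddSubgroup.mem_zmultiples (T' t))]

theorem eq_of_mem_zmultiples_T' {P : EPt (E' t)} (h : P ∈ AddSubgroup.zmultiples (T' t)) :
    P = 0 ∨ P = T' t ∨ P = D' t ∨ P = -T' t := by
  have h4 : (4 : ℤ) • T' t = 0 := by exact_mod_cast four_nsmul_T' t
  obtain ⟨k, rfl⟩ := h
  change k • T' t = 0 ∨ k • T' t = T' t ∨ k • T' t = D' t ∨ k • T' t = -T' t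
  have hk : k • T' t = (k % 4) • T' t := by
    conv_lhs => rw [← Int.emod_add_mul_ediv k 4]
    rw [add_zsmul, mul_comm, mul_zsmul, h4, zsmul_zero, add_zero]
  rw [hk]
  have h0 := Int.emod_nonneg k (by norm_num : (4 : ℤ) ≠ 0)
  have h1 := Int.emod_lt_of_pos k (by norm_num : (0 : ℤ) < 4)
  obtain h | h | h | h : k % 4 = 0 ∨ k % 4 = 1 ∨ k % 4 = 2 ∨ k % 4 = 3 := by omega
  · exact Or.inl (by rw [h, zero_zsmul])
  · exact Or.inr (Or.inl (by rw [h, one_zsmul]))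
  · exact Or.inr (Or.inr (Or.inl (by rw [h, two_zsmul, T'_add_T'])))
  · exact Or.inr (Or.inr (Or.inr (by
      rw [h, show (3 : ℤ) = 4 - 1 from rfl, sub_zsmul, h4, one_zsmul, zero_add])))

theorem D'_add_T' : D' t + T' t = -T' t := by
  rw [eq_neg_iff_add_eq_zero, add_assoc, T'_add_T', D'_add_D']

/-- Outside the kernel of `φ̂` this is `add_T'_coord`; the kernel consists of the four multiples
of `T'`, for which the coordinates are known. -/
theorem vecC_add_T' (P : EPt (E' t)) :
    ∃ c : Qbar, vecC t (P + T' t) = c • scaleLin (-im) (vecC t P) := by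
  have hA := Ab_ne_zero t
  have ht := tb_ne_zero t
  by_cases hP : phiHat t P = 0
  · rw [phiHat_eq_zero_iff] at hP
    have hi : (-im) ^ 3 = im := by linear_combination -im * im_sq
    obtain ⟨c, hc⟩ : ∃ c, c = 2 * tb t * Ab t ^ 2 := ⟨_, rfl⟩
    have hc0 : c ≠ 0 := by
      rw [hc]
      exact mul_ne_zero (mul_ne_zero two_ne_zero ht) (pow_ne_zero 2 hA)
    obtain rfl | rfl | rfl | rfl := eq_of_mem_zmultiples_T' t hP
    · refine ⟨-c, ?_⟩
      rw [zero_add, vecC_T', vecC_zero, ← hc]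
      ext i
      fin_cases i <;> simp [scaleLin, im_sq, hi]
    · refine ⟨-c⁻¹, ?_⟩
      rw [T'_add_T', vecC_T', vecC_D', ← hc, map_smul, smul_smul, neg_mul, inv_mul_cancel₀ hc0]
      ext i
      fin_cases i <;> simp [scaleLin, im_sq, hi, ← pow_two]
    · refine ⟨-c, ?_⟩
      rw [D'_add_T', vecC_neg_T', vecC_D', ← hc]
      ext i
      fin_cases i <;> simp [scaleLin, im_sq, hi]
    · refine ⟨-c⁻¹, ?_⟩
      rw [neg_add_cancel, vecC_neg_T', vecC_zero, ← hc, map_smul, smul_smul, neg_mul,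
        inv_mul_cancel₀ hc0]
      ext i
      fin_cases i <;> simp [scaleLin, im_sq, hi, ← pow_two]
  · have hP' := mt (phiHat_add_T'_eq_zero_iff t P).mp hP
    obtain _ | ⟨X, Y, h⟩ := P
    · exact absurd rfl hP
    rw [phiHat_some_eq_zero_iff, not_not] at hP
    obtain ⟨hX1, hX2⟩ := hP
    obtain ⟨l, X₃, Y₃, h₃, e, hl, hX₃, hY₃⟩ := some_add_T' t h hX2
    rw [e, phiHat_some_eq_zero_iff, not_not] at hP'
    obtain ⟨hX3, hX4⟩ := hP'
    obtain ⟨h1, h2⟩ := add_T'_coord t (E'_equation_of_nonsingular t h) hX2 hl hX₃ hY₃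
    rw [e, vecC_some_of_ne t _ hX3, vecC_some_of_ne t _ hX1]
    refine ⟨im * (X₃ + Ab t) * (X₃ + 2 * Ab t) / ((X + Ab t) * (X + 2 * Ab t)), ?_⟩
    ext i
    rw [Pi.smul_apply, smul_eq_mul, div_mul_eq_mul_div, eq_div_iff (mul_ne_zero hX1 hX2)]
    fin_cases i <;>
      simp only [coordC, scaleLin, Fin.zero_eta, Fin.mk_one, Fin.reduceFinMk, Matrix.cons_val,
        LinearMap.coe_mk, AddHom.coe_mk]
    · linear_combination (4 * tb t * (X₃ + Ab t) * (X₃ + 2 * Ab t) * (X + Ab t) *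
        (X + 2 * Ab t)) * im_sq
    · linear_combination ((X₃ + Ab t) * (X + 2 * Ab t)) * h1 +
        ((X + Ab t) * (X₃ + 2 * Ab t)) * h2 - (im * (X₃ + Ab t) * (X₃ + 2 * Ab t) *
        (2 * (2 * Y + X + Ab t) * (X + 2 * Ab t) + tb t * X * (X + Ab t))) * im_sq
    · apply mul_left_cancel₀ ht
      linear_combination (2 * (2 * Y₃ + X₃ + Ab t) * (X + 2 * Ab t)) * h1 -
        (2 * im * (2 * Y + X + Ab t) * (X₃ + 2 * Ab t)) * h2 +
        (2 * tb t * (2 * Y + X + Ab t) * X * (X₃ + Ab t) * (X₃ + 2 * Ab t) * im ^ 2) * im_sq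
    · linear_combination ((X + Ab t) * (X₃ + 2 * Ab t)) * h2 -
        ((X₃ + Ab t) * (X + 2 * Ab t)) * h1

end Translation

/-! ### Homogeneous spaces with the same cohomology class are equivalent -/

section Injectivity

variable {W : WeierstrassCurve ℚ}

namespace TorsorStructure

variable {n : ℕ} {C : ProjVar n} (μ : TorsorStructure W C)

theorem smul_diff (σ : GQ) (p q : C.Pt) : σ • μ.diff p q = μ.diff (σ • p) (σ • q) := by
  symm
  rw [diff_eq_iff, ← galois_act, act_diff]

theorem diff_add_diff (p q r : C.Pt) : μ.diff q r + μ.diff p q = μ.diff p r := by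
  symm
  rw [diff_eq_iff, act_add, act_diff, act_diff]

theorem regularAt_act (p : C.Pt) (P : EPt W) : RegularAt (embE W) C.emb (μ.act p) P :=
  (isRegular₂_iff.mp μ.regular_act p P).right

theorem regularAt_diff (p q : C.Pt) : RegularAt C.emb (embE W) (fun p => μ.diff p q) p :=
  (isRegular₂_iff.mp μ.regular_diff p q).left

end TorsorStructure

/-- The equivalence is `x ↦ q + (x - p)`. -/
theorem HomogeneousSpace.equivalent_of_cocycle_eq {X Y : HomogeneousSpace W} {p : X.curve.Pt}
    {q : Y.curve.Pt} (h : ∀ σ : GQ, X.torsor.diff (σ • p) p = Y.torsor.diff (σ • q) q) :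
    X.Equivalent Y := by
  let e : X.curve.Pt ≃ Y.curve.Pt :=
    { toFun := fun x => Y.torsor.act q (X.torsor.diff x p)
      invFun := fun y => X.torsor.act p (Y.torsor.diff y q)
      left_inv := fun x => by simp only [Y.torsor.diff_act, X.torsor.act_diff]
      right_inv := fun y => by simp only [X.torsor.diff_act, Y.torsor.act_diff] }
  refine ⟨e, ?_, ?_, fun σ x => ?_, fun x P => ?_⟩
  · exact isRegular_iff.mpr fun x => RegularAt.comp (κ := embE W) (g := Y.torsor.act q)
      (Y.torsor.regularAt_act _ _) (X.torsor.regularAt_diff _ _)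
  · exact isRegular_iff.mpr fun x => RegularAt.comp (κ := embE W) (g := X.torsor.act p)
      (X.torsor.regularAt_act _ _) (Y.torsor.regularAt_diff _ _)
  · change Y.torsor.act q (X.torsor.diff (σ • x) p) = σ • Y.torsor.act q (X.torsor.diff x p)
    rw [Y.torsor.galois_act, X.torsor.smul_diff, ← X.torsor.diff_add_diff _ (σ • p), h,
      Y.torsor.act_add, Y.torsor.act_diff]
  · change Y.torsor.act q (X.torsor.diff (X.torsor.act x P) p) =
      Y.torsor.act (Y.torsor.act q (X.torsor.diff x p)) P
    rw [← Y.torsor.act_add, ← X.torsor.diff_add_diff _ x, X.torsor.diff_act]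

theorem WC.toH1_injective : Function.Injective (WC.toH1 (W := W)) := by
  rintro ⟨X⟩ ⟨Y⟩ h
  refine Quot.sound ?_
  change X.cohomologyClass = Y.cohomologyClass at h
  rw [HomogeneousSpace.cohomologyClass, HomogeneousSpace.cohomologyClass] at h
  set p := Classical.choice X.torsor.nonempty
  set q := Classical.choice Y.torsor.nonempty
  obtain ⟨m, hm⟩ := QuotientAddGroup.eq.mp h
  -- moving the base point of `Y` by `-m` makes the two crossed homomorphisms equal
  refine HomogeneousSpace.equivalent_of_cocycle_eq (p := p) (q := Y.torsor.act q (-m)) fun σ => ?_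
  have hσ : -X.torsor.diff (σ • p) p + Y.torsor.diff (σ • q) q = σ • m - m := hm σ
  symm
  rw [TorsorStructure.diff_eq_iff, Y.torsor.galois_act, ← Y.torsor.act_add,
    ← Y.torsor.act_diff q (σ • q), ← Y.torsor.act_add, smul_neg]
  congr 1
  have h' : Y.torsor.diff (σ • q) q = X.torsor.diff (σ • p) p + (σ • m - m) := by
    rw [← hσ]; abel
  rw [h']
  abel

end Injectivity

/-! ### Twisting by a fourth root of `d` -/

section Twist

variable (t : ℚˣ)

theorem im_pow_pow_mul_db (n : ℕ) : (im ^ n) ^ 4 * db 1 = db 1 := by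
  have h4 : im ^ 4 = 1 := by linear_combination (im ^ 2 - 1) * im_sq
  rw [← pow_mul, mul_comm n, pow_mul, h4, one_pow, one_mul]

theorem neg_im_pow_mul_db : (-im) ^ 4 * db 1 = db 1 := by
  linear_combination (im ^ 2 - 1) * db 1 * im_sq

/-- Translation by `T'` on `E'` corresponds to `(z, w) ↦ (-i z, -w)` on `C'_1`. -/
theorem psi_add_T' (P : EPt (E' t)) :
    psi t (P + T' t) = scale t (neg_ne_zero.mpr im_ne_zero) neg_im_pow_mul_db (psi t P) := by
  obtain ⟨c, hc⟩ := vecC_add_T' t P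
  exact psi_eq_of_smul t _ hc

/-- The automorphism `(z, w) ↦ (i z, -w)` of `C'_1` corresponds to translation by `-T'` on `E'`. -/
theorem psiEquiv_symm_scale_im (n : ℕ) (p : (C' t 1).Pt) :
    (psiEquiv t).symm (scale t (pow_ne_zero n im_ne_zero) (im_pow_pow_mul_db n) p) =
      (psiEquiv t).symm p - n • T' t := by
  have key : ∀ P : EPt (E' t), psi t P =
      scale t (pow_ne_zero n im_ne_zero) (im_pow_pow_mul_db n) (psi t (P + n • T' t)) := by
    induction n with
    | zero =>
      intro P
      rw [zero_nsmul, add_zero, scale_congr t _ _ (pow_zero im), scale_one]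
    | succ n ih =>
      intro P
      have h : im ^ (n + 1) * -im = im ^ n := by linear_combination -im ^ n * im_sq
      rw [succ_nsmul, ← add_assoc, psi_add_T', scale_scale, scale_congr t _ _ h, ← ih]
  rw [Equiv.symm_apply_eq]
  change _ = psi t _
  rw [key, sub_add_cancel]
  congr 1
  exact ((psiEquiv t).apply_symm_apply p).symm

variable {d : ℚˣ} {α : Qbar}

theorem IsFourthRoot.inv_pow_mul_db (hα : IsFourthRoot d α) : α⁻¹ ^ 4 * db d = db 1 := by
  rw [db_one, inv_pow, db, ← (hα : α ^ 4 = _), inv_mul_cancel₀ (pow_ne_zero 4 hα.ne_zero)]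

/-- The isomorphism `θ : C'_d ≃ E'` attached to a fourth root `α` of `d`: the rescaling
`(z, w) ↦ (z / α, w / α²)` from `C'_d` to `C'_1`, followed by the inverse of `psi`. -/
def theta (hα : IsFourthRoot d α) : (C' t d).Pt ≃ EPt (E' t) :=
  (scaleEquiv t (inv_ne_zero hα.ne_zero) hα.inv_pow_mul_db).trans (psiEquiv t).symm

theorem isRegular_theta (hα : IsFourthRoot d α) :
    IsRegular (C' t d).emb (embE (E' t)) (theta t hα) :=
  isRegular_iff.mpr fun _ => RegularAt.comp (κ := (C' t 1).emb) (g := (psiEquiv t).symm)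
    (regularAt_psiEquiv_symm t _)
    (regularAt_scale t (inv_ne_zero hα.ne_zero) hα.inv_pow_mul_db _)

theorem isRegular_theta_symm (hα : IsFourthRoot d α) :
    IsRegular (embE (E' t)) (C' t d).emb (theta t hα).symm :=
  isRegular_iff.mpr fun _ => RegularAt.comp (κ := (C' t 1).emb) (f := psiEquiv t)
    (g := (scaleEquiv t (inv_ne_zero hα.ne_zero) hα.inv_pow_mul_db).symm)
    (regularAt_scale t (inv_ne_zero (inv_ne_zero hα.ne_zero))
      (by rw [inv_inv, db_one, mul_one]; exact hα) _)
    (regularAt_psiEquiv t _)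

/-- `θ` fails to commute with `σ` by the translation by the value at `σ` of the crossed
homomorphism attached to `d`. -/
theorem theta_smul (hα : IsFourthRoot d α) {σ : GQ} {m : ℕ} (h : σ α = im ^ m * α)
    (p : (C' t d).Pt) : theta t hα (σ • p) = σ • theta t hα p - m • T' t := by
  obtain ⟨he, h', e⟩ := smul_scale t σ (inv_ne_zero hα.ne_zero) hα.inv_pow_mul_db p
  have hα' : im ^ m * σ α⁻¹ = α⁻¹ := by
    have := hα.ne_zero
    have := pow_ne_zero m im_ne_zero
    rw [map_inv₀, h]
    field_simp
  change (psiEquiv t).symm (scale t (inv_ne_zero hα.ne_zero) hα.inv_pow_mul_db (σ • p)) =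
    σ • (psiEquiv t).symm (scale t (inv_ne_zero hα.ne_zero) hα.inv_pow_mul_db p) - _
  rw [← psiEquiv_symm_smul, ← psiEquiv_symm_scale_im, e, scale_scale]
  congr 1
  exact (scale_congr t _ _ hα' _).symm

/-- The homogeneous space structure `p + P = θ⁻¹ (θ(p) - P)` on `C'_d`, with difference
`q - p = θ(p) - θ(q)`. -/
def torsorC' (hα : IsFourthRoot d α) : TorsorStructure (E' t) (C' t d) where
  nonempty := ⟨(theta t hα).symm 0⟩
  act p P := (theta t hα).symm (theta t hα p - P)
  diff q p := theta t hα p - theta t hα q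
  act_zero p := by rw [sub_zero, Equiv.symm_apply_apply]
  act_add p P Q := by rw [Equiv.apply_symm_apply, sub_add_eq_sub_sub]
  act_diff p q := by rw [sub_sub_cancel, Equiv.symm_apply_apply]
  diff_act p P := by rw [Equiv.apply_symm_apply, sub_sub_cancel]
  regular_act := isRegular₂_iff.mpr fun p P =>
    RegularAt.comp₂ (lam := embE (E' t)) (g := (theta t hα).symm)
      (isRegular_iff.mp (isRegular_theta_symm t hα) _)
      (RegularAt₂.comp (f := fun S T => S - T) (g := theta t hα) (h := fun P => P)
        (ι := embE (E' t)) (κ := embE (E' t)) (regularAt₂_sub t _ _)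
        (isRegular_iff.mp (isRegular_theta t hα) _) (regularAt_id _))
  regular_diff := isRegular₂_iff.mpr fun q p =>
    (RegularAt₂.comp (f := fun S T => S - T) (g := theta t hα) (h := theta t hα)
      (ι := embE (E' t)) (κ := embE (E' t)) (regularAt₂_sub t _ _)
      (isRegular_iff.mp (isRegular_theta t hα) p)
      (isRegular_iff.mp (isRegular_theta t hα) q)).swap
  galois_act σ p P := by
    obtain ⟨m, hm⟩ := hα.exists_pow (hα.gal σ)
    rw [Equiv.eq_symm_apply, theta_smul t hα hm, theta_smul t hα hm, Equiv.apply_symm_apply,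
      smul_sub]
    abel

theorem torsorC'_diff_smul_base (hα : IsFourthRoot d α) (σ : GQ) :
    (torsorC' t hα).diff (σ • (theta t hα).symm 0) ((theta t hα).symm 0) = kummerFun t α σ := by
  obtain ⟨m, hm⟩ := hα.exists_pow (hα.gal σ)
  rw [kummerFun_eq t hα.ne_zero hm]
  change theta t hα _ - theta t hα _ = m • T' t
  rw [theta_smul t hα hm, Equiv.apply_symm_apply, smul_zero, zero_sub, zero_sub,
    neg_neg]

/-- Taken at the base point `θ⁻¹(0)`, the crossed homomorphism of `C'_d` is the Kummer crossed
homomorphism of `d`. -/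
theorem toH1_torsorC' :
    (WC.mk ⟨3, C' t d, torsorC' t (fourthRoot_spec d)⟩).toH1 = deltaE' t (QuotientGroup.mk d) := by
  change (QuotientAddGroup.mk ((torsorC' t (fourthRoot_spec d)).cocycle _) : H1 (EPt (E' t))) =
    QuotientAddGroup.mk (Z1.map (kerPhiHat t).subtype _ (kummerCocycle t (fourthRoot_spec d)))
  rw [TorsorStructure.cocycle_class_eq _ _ ((theta t (fourthRoot_spec d)).symm 0)]
  congr 1
  exact Subtype.ext (funext fun σ => torsorC'_diff_smul_base t (fourthRoot_spec d) σ)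

/-- Through `psi`, the isogeny `φ̂` is
`[z : w : u : s] ↦ (u² / z² - a, (u² / z² - a)² - s⁴ / z⁴)`. -/
theorem phiHat_eq_of_coordC {X Y x y : Qbar} (h) (hX : coordC t X Y 0 ≠ 0)
    (hx : -ab t + (coordC t X Y 2 / coordC t X Y 0) ^ 2 = x)
    (hy : x ^ 2 - (coordC t X Y 3 / coordC t X Y 0) ^ 4 = y) :
    ∃ h', phiHat t (.some X Y h) = .some x y h' := by
  have hX' : X + Ab t ≠ 0 ∧ X + 2 * Ab t ≠ 0 := by
    simpa [coordC, tb_ne_zero] using hX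
  have h1 := hX'.1
  have h2 := hX'.2
  have ht := tb_ne_zero t
  have e1 : X * (2 * Y + X + Ab t) / (2 * tb t * (X + Ab t) * (X + 2 * Ab t)) =
      coordC t X Y 2 / coordC t X Y 0 := by
    simp only [coordC, Matrix.cons_val]
    field_simp
    ring
  have e2 : (2 * (X + 2 * Ab t) * (2 * Y + X + Ab t) - tb t * X * (X + Ab t)) /
      (4 * tb t * (X + Ab t) * (X + 2 * Ab t)) = coordC t X Y 3 / coordC t X Y 0 := by
    simp only [coordC, Matrix.cons_val]
    congr 1
    ring
  have ex : isogX t X Y = x := by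
    rw [isogX, e1, hx]
  have ey : isogY t X Y = y := by
    rw [isogY, ex, e2, hy]
  subst ex ey
  exact ⟨_, dif_pos hX'⟩

/-- Since `z = α z'`, `w = α² w'`, `u = α³ u'` for the point `[z' : w' : u' : 1]` of `C'_1`
corresponding to `(z, w)`, the formula for `φ̂` on `C'_1` gives `(w / z², (w² - d) / z⁴)` by the
equation of `C'_d`. -/
theorem phiHat_theta (hα : IsFourthRoot d α) {z w : Qbar} (h : OnC' t d z w) (hz : z ≠ 0) :
    ∃ h', phiHat t (theta t hα (C'.pt t d h hz)) =
      .some (w / z ^ 2) ((w ^ 2 - db d) / z ^ 4) h' := by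
  have hα0 := hα.ne_zero
  have hα4 : α ^ 4 = db d := hα
  obtain ⟨P, hP⟩ : ∃ P, P = theta t hα (C'.pt t d h hz) := ⟨_, rfl⟩
  have e : psi t P = scale t (inv_ne_zero hα0) hα.inv_pow_mul_db (C'.pt t d h hz) := by
    rw [hP]
    exact (psiEquiv t).apply_symm_apply _
  obtain ⟨c, hc⟩ := (Projectivization.mk_eq_mk_iff' Qbar _ _ _ _).mp (congrArg Subtype.val e)
  have hc0 : c ≠ 0 := by
    rintro rfl
    exact vecC_ne_zero t P (by rw [← hc, zero_smul])
  have h0 := congrFun hc 0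
  have h2 := congrFun hc 2
  have h3 := congrFun hc 3
  simp only [scaleLin, LinearMap.coe_mk, AddHom.coe_mk, Pi.smul_apply, smul_eq_mul,
    Matrix.cons_val] at h0 h2 h3
  rw [← hP]
  have hne : vecC t P 0 ≠ 0 := by
    rw [← h0]
    exact mul_ne_zero hc0 (mul_ne_zero (inv_ne_zero hα0) hz)
  clear hP e hc
  induction P using point_cases with
  | h0 => exact absurd rfl hne
  | hD => exact absurd (by rw [vecC_D']; rfl) hne
  | h X Y hXY hX =>
    rw [vecC_some_of_ne t hXY hX] at h0 h2 h3 hne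
    have e2 : (coordC t X Y 2 / coordC t X Y 0) ^ 2 = (w ^ 2 - db d) ^ 2 / (z ^ 4 * db d) := by
      rw [← h0, ← h2, ← hα4]
      field_simp
    have e3 : (coordC t X Y 3 / coordC t X Y 0) ^ 4 = db d / z ^ 4 := by
      rw [← h0, ← h3, ← hα4]
      field_simp
    have hd : db d ≠ 0 := hα4 ▸ pow_ne_zero 4 hα0
    have ex : -ab t + (coordC t X Y 2 / coordC t X Y 0) ^ 2 = w / z ^ 2 := by
      rw [e2, ← (h : db d * (w + ab t * z ^ 2) * z ^ 2 = (w ^ 2 - db d) ^ 2)]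
      field_simp
      ring
    refine phiHat_eq_of_coordC t hXY hne ex ?_
    rw [e3]
    field_simp

end Twist

end FourDescent

end

/-- For every `d`: the class of `C'_d`, with a suitable action of `E'`, is the one and only element
of `WC(E'/ℚ)` whose class in `H¹(Gal(ℚ̄/ℚ), E')` is the image of `δ_ℚ(d)`; and there is an
isomorphism `θ : C'_d → E'` over `ℚ̄`, compatible with the action up to the sign dictated by the
convention `{C} ↦ {σ ↦ σ(p₀) - p₀}`, such that `φ̂ ∘ θ` is
`(z, w) ↦ (w / z², (w² - d) / z⁴)`. -/
theorem mainTheorem6 (t d : ℚˣ) :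
    ∃ (μ : FourDescent.TorsorStructure (FourDescent.E' t) (FourDescent.C' t d))
      (θ : (FourDescent.C' t d).Pt ≃ FourDescent.EPt (FourDescent.E' t)),
      (∀ x : FourDescent.WC (FourDescent.E' t),
        x.toH1 = FourDescent.deltaE' t (QuotientGroup.mk d) ↔
          x = FourDescent.WC.mk ⟨3, FourDescent.C' t d, μ⟩) ∧
      FourDescent.IsRegular (FourDescent.C' t d).emb (FourDescent.embE (FourDescent.E' t)) θ ∧
      FourDescent.IsRegular (FourDescent.embE (FourDescent.E' t)) (FourDescent.C' t d).emb θ.symm ∧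
      (∀ p P, θ (μ.act p P) = θ p - P) ∧
      ∀ (z w : FourDescent.Qbar) (h : FourDescent.OnC' t d z w) (hz : z ≠ 0),
        ∃ h', FourDescent.phiHat t (θ (FourDescent.C'.pt t d h hz)) =
          .some (w / z ^ 2) ((w ^ 2 - FourDescent.db d) / z ^ 4) h' := by
  have hα := FourDescent.fourthRoot_spec d
  refine ⟨FourDescent.torsorC' t hα, FourDescent.theta t hα, fun x => ?_,
    FourDescent.isRegular_theta t hα, FourDescent.isRegular_theta_symm t hα,
    fun p P => Equiv.apply_symm_apply _ _, fun z w h hz => FourDescent.phiHat_theta t hα h hz⟩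
  rw [← FourDescent.toH1_torsorC' t, FourDescent.WC.toH1_injective.eq_iff]
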